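/- **Theorem 2.1.** Let $\tilde{\mathcal R}$ be a random closed subset of $[0,1]$ with zero Lebesgue measure almost surely (a fixed closed set being a special case), and let $u_1,u_2,\dots$ be independent random variables, uniformly distributed on $[0,1]$ and independent of $\tilde{\mathcal R}$. For $x>0$ let $\tilde N_x$ be the number of gaps of $\tilde{\mathcal R}$ (interval components of $[0,1]\setminus\tilde{\mathcal R}$) of length at least $x$. Put two different sample points $u_i<u_j$, $i,j\le n$, in the same block if and only if $\tilde{\mathcal R}\cap[u_i,u_j]=\varnothing$, and let $\mathcal C_n$ be the composition of $n$ that records the block sizes from left to right. Let $K_n$ be the number of parts of $\mathcal C_n$ and $K_{n,r}$ the number of its parts equal to $r$. Let $\ell$ be slowly varying at $\infty$, that is, measurable and positive on some half-line $[X,\infty)$, $X>0$, with $\ell(ct)/\ell(t)\to1$ as $t\to\infty$ for every $c>0$. Let $L$ be a non-negative random variable and let $0<\alpha\le1$. Suppose that $$\frac{\tilde N_x}{\ell(1/x)\,x^{-\alpha}}\to L\quad\text{a.s. as }x\downarrow0 .$$ (a) If $0<\alpha<1$, then almost surely, as $n\to\infty$, $$\frac{K_n}{n^\alpha\ell(n)}\to\Gamma(1-\alpha)\,L,\qquad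 \frac{K_{n,r}}{n^\alpha\ell(n)}\to\frac{\alpha\,\Gamma(r-\alpha)}{r!}\,L\quad\text{for all } r\ge1 .$$ (b) If $\alpha=1$, then almost surely, as $n\to\infty$, $$\frac{K_{n,r}}{n\,\ell(n)}\to\frac{1}{r(r-1)}\,L\quad\text{for all } r>1 .$$ (c) Let $\alpha=1$ and $$\ell^*(t)=\int_0^\infty\frac{e^{-1/y}}{y}\,\ell(ty)\,dy .$$ If $L$ is not almost surely $0$, and if for some $t_0>0$ the integral $\ell^*(t_0)$, restricted to $(0,b]$, converges absolutely for every $b>0$ (a condition on $\ell$ on bounded sets only), then the whole integral $\ell^*(t_0)$ converges absolutely. If, for some $t_0>0$, the integral $\ell^*(t_0)$ converges absolutely, then $\ell^*(t)$ converges absolutely for all $t\ge t_0$, the function $\ell^*$ is slowly varying at $\infty$, and almost surely, as $n\to\infty$, $$\frac{K_n}{n\,\ell^*(n)}\to L,\qquad \frac{K_{n,1}}{n\,\ell^*(n)}\to L .$$ -/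

import Mathlib

open MeasureTheory ProbabilityTheory Filter Topology Set

/-- The Effros σ-algebra on the closed subsets of the line, generated by the hitting events
`{F | F ∩ G ≠ ∅}` with `G` open. A random closed set is a measurable map into this space. -/
instance effrosMeasurableSpace : MeasurableSpace (TopologicalSpace.Closeds ℝ) :=
  MeasurableSpace.generateFrom
    {A | ∃ G : Set ℝ, IsOpen G ∧ A = {F : TopologicalSpace.Closeds ℝ | ((F : Set ℝ) ∩ G).Nonempty}}

/-- The gaps of a set `F ⊆ [0,1]`: the interval components of `[0,1] \ F`. -/
def gaps (F : Set ℝ) : Set (Set ℝ) :=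
  {C | ∃ p ∈ Icc (0 : ℝ) 1 \ F, C = connectedComponentIn (Icc (0 : ℝ) 1 \ F) p}

/-- The number of gaps of `F` of length at least `x`. (It is finite for `F` closed and `x > 0`.) -/
noncomputable def gapCount (F : Set ℝ) (x : ℝ) : ℕ :=
  {C ∈ gaps F | x ≤ volume.real C}.ncard

/-- Two sample points are in the same block when they are not separated by `F`, that is, when `F`
does not meet the closed interval between them; a sample point in `F` is a block by itself. -/
def blockSetoid (F : Set ℝ) {n : ℕ} (v : Fin n → ℝ) : Setoid (Fin n) where
  r i j := i = j ∨ F ∩ uIcc (v i) (v j) = ∅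
  iseqv :=
    { refl := fun i => Or.inl rfl
      symm := by
        rintro i j (h | h)
        · exact Or.inl h.symm
        · exact Or.inr (by rwa [uIcc_comm])
      trans := by
        rintro i j k (rfl | h) (rfl | h')
        · exact Or.inl rfl
        · exact Or.inr h'
        · exact Or.inr h
        · refine Or.inr ?_
          rw [← disjoint_iff_inter_eq_empty] at h h' ⊢
          exact (h.union_right h').mono_right uIcc_subset_uIcc_union_uIcc }

open Classical in
/-- The partition of the sample into blocks. -/
noncomputable def blockPartition (F : Set ℝ) {n : ℕ} (v : Fin n → ℝ) :
    Finpartition (Finset.univ : Finset (Fin n)) :=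
  Finpartition.ofSetoid (blockSetoid F v)

/-- The blocks, listed from left to right (by the position of their leftmost points). -/
noncomputable def blockList (F : Set ℝ) {n : ℕ} (v : Fin n → ℝ) : List (Finset (Fin n)) :=
  open Classical in
  (blockPartition F v).parts.toList.mergeSort
    (fun B C => decide (sInf (v '' (B : Set (Fin n))) ≤ sInf (v '' (C : Set (Fin n)))))

/-- The composition of `n` derived from `F` by separating the points `v 0, …, v (n-1)`:
the record of block sizes, ordered from left to right. -/
noncomputable def derivedComposition (F : Set ℝ) {n : ℕ} (v : Fin n → ℝ) : Composition n where
  blocks := (blockList F v).map Finset.card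
  blocks_pos := by
    intro i hi
    obtain ⟨B, hB, rfl⟩ := List.mem_map.1 hi
    have hB' : B ∈ (blockPartition F v).parts := by
      simpa [blockList] using hB
    exact Finset.card_pos.2 ((blockPartition F v).nonempty_of_mem_parts hB')
  blocks_sum := by
    have h1 : ((blockList F v).map Finset.card).sum
        = ((blockPartition F v).parts.toList.map Finset.card).sum :=
      ((List.mergeSort_perm _ _).map _).sum_eq
    rw [h1, Finset.sum_map_toList, (blockPartition F v).sum_card_parts]
    simp

/-- The number of parts of the composition derived from `F` and the first `n` points of `u`. -/
noncomputable def numParts (F : Set ℝ) (u : ℕ → ℝ) (n : ℕ) : ℕ :=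
  (derivedComposition F (fun i : Fin n => u i)).length

/-- The number of parts equal to `r` in the composition derived from `F` and the first `n` points
of `u`. -/
noncomputable def numPartsEq (F : Set ℝ) (u : ℕ → ℝ) (n r : ℕ) : ℕ :=
  (derivedComposition F (fun i : Fin n => u i)).blocks.count r

/-- Slow variation at infinity: `f` is measurable and positive on some half-line `[X, ∞)`, and
`f (c t) / f t → 1` as `t → ∞` for every `c > 0`. -/
def SlowlyVarying (f : ℝ → ℝ) : Prop :=
  (∃ X : ℝ, 0 < X ∧ AEMeasurable f (volume.restrict (Ici X)) ∧ ∀ t, X ≤ t → 0 < f t) ∧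
    ∀ c : ℝ, 0 < c → Tendsto (fun t => f (c * t) / f t) atTop (𝓝 1)

/-- The integrand of `ℓ^*(t)`. -/
noncomputable def starIntegrand (l : ℝ → ℝ) (t y : ℝ) : ℝ :=
  Real.exp (-(1 / y)) / y * l (t * y)

/-- `ℓ^*(t) = ∫₀^∞ (e^{-1/y} / y) ℓ(t y) dy`. -/
noncomputable def lstar (l : ℝ → ℝ) (t : ℝ) : ℝ :=
  ∫ y in Ioi (0 : ℝ), starIntegrand l t y

/-! Fix a realisation `F` of the random set. Since `F` is null, almost surely every sample point
falls in a gap, and two points share a block exactly when they share a gap. The blocks are therefore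
the occupied boxes of an occupancy scheme whose box frequencies are the gap lengths. Let `Z n s` be
the number of gaps with more than `s` of the first `n` points; then `K_n = Z n 0` and `K_{n,s+1} = Z
n s - Z n (s+1)`.

Mean. A gap of length `p` receives more than `s` points with probability `∫₀^p` of the density of
the `(s+1)`-st order statistic. Summing over the gaps, by Tonelli, gives `E Z n s = ∫ N(x)
orderDensity n s x dx`, where `N` counts the gaps of length at least `x`. The substitution `x = y /
n` turns the density into the Poisson weight `e^{-y} y^s / s!` and `N(y/n)` into `λ y^{-α} n^α
ℓ(n)`. Potter bounds allow dominated convergence as long as `α < s + 1`, and the limit is `λ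
Γ(s+1-α) / s!`. Differences in `s` give the constants for `K_{n,r}`
(`tendsto_integral_orderDensity`).

The case `α = 1`, `s = 0`. The limiting integral diverges at `0`, and the order of growth is larger
than `n ℓ(n)`. The mean `n ∫ N(x) (1-x)^{n-1} dx` is compared with `n` times the Laplace transform
of `N`. Under `x = 1/s` this transform has the same kernel as `ℓ^*`, and an Abelian theorem gives `λ
n ℓ^*(n)`. Since `ℓ = o(ℓ^*)`, gaps with two or more points are negligible, so `K_n` and `K_{n,1}`
have the same limit.

Almost sure convergence. Occupancy numbers of disjoint sets are negatively correlated (by the FKG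
inequality), so the variance of `Z n s` is at most its mean. Along `n = k^m` with `m` large the
normalised variances are summable, and monotonicity in `n` fills the gaps between consecutive powers
(`ae_tendsto_of_variance_le`).

Random set. By independence and Fubini the result for fixed sets carries over
(`ae_tendsto_of_indepFun`); this needs the block counts to be jointly measurable in the set and the
sample. -/

/-! ### Slow variation: uniform convergence and Potter bounds -/

namespace SlowlyVarying

variable {f : ℝ → ℝ}

theorem eventually_pos (hf : SlowlyVarying f) : ∀ᶠ t in atTop, 0 < f t := by
  obtain ⟨⟨X, -, -, hpos⟩, -⟩ := hf
  filter_upwards [eventually_ge_atTop X] with t ht using hpos t ht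

theorem aemeasurable_comp_mul {X : ℝ}
    (hm : AEMeasurable f (volume.restrict (Ici X))) {x : ℝ} (hx : 0 < x) :
    AEMeasurable (fun c => f (c * x)) (volume.restrict (Ici (X / x))) := by
  have hq : Measure.QuasiMeasurePreserving (fun c : ℝ => c * x)
      (volume.restrict (Ici (X / x))) (volume.restrict (Ici X)) := by
    refine ⟨measurable_mul_const x, ?_⟩
    rw [show Ici (X / x) = (fun c : ℝ => c * x) ⁻¹' Ici X by
      ext c; simp [div_le_iff₀ hx]]
    rw [← Measure.restrict_map (measurable_mul_const x) measurableSet_Ici,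
      Real.map_volume_mul_right hx.ne']
    rw [Measure.restrict_smul]
    exact Measure.smul_absolutelyContinuous
  exact hm.comp_quasiMeasurePreserving hq

/-- The set of `c ∈ [1, 4]` for which `f (c x) / f x` is not yet close to `1` has vanishing
measure. -/
theorem tendsto_measure_exceptional (hf : SlowlyVarying f) {ε : ℝ} (hε : 0 < ε) :
    Tendsto (fun x => volume {c ∈ Icc (1 : ℝ) 4 | ε ≤ |f (c * x) / f x - 1|}) atTop (𝓝 0) := by
  obtain ⟨⟨X, hX, hm, hpos⟩, hlim⟩ := hf
  -- Pointwise convergence implies convergence in measure along sequences, and sequences suffice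
  -- because `atTop` on the line is countably generated. The shift by `n₀` below makes every
  -- function of the sequence measurable on `[1, 4]`.
  refine tendsto_of_seq_tendsto fun x hx => ?_
  have hev : ∀ᶠ n in atTop, X ≤ x n := hx.eventually_ge_atTop X
  obtain ⟨n₀, hn₀⟩ := eventually_atTop.1 hev
  rw [← tendsto_add_atTop_iff_nat n₀]
  have key : TendstoInMeasure (volume.restrict (Icc (1 : ℝ) 4))
      (fun n c => f (c * x (n + n₀)) / f (x (n + n₀))) atTop (fun _ => (1 : ℝ)) := by
    refine tendstoInMeasure_of_tendsto_ae (fun n => ?_) ?_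
    · have hxn : X ≤ x (n + n₀) := hn₀ _ (Nat.le_add_left _ _)
      have h1 := (aemeasurable_comp_mul hm (hX.trans_le hxn)).mono_measure
        (Measure.restrict_mono (s := Icc (1 : ℝ) 4) (fun c hc => ?_) le_rfl)
      · exact (h1.div_const _).aestronglyMeasurable
      · exact ((div_le_one (hX.trans_le hxn)).2 hxn).trans hc.1
    · filter_upwards [ae_restrict_mem measurableSet_Icc] with c hc
      exact (hlim c (by linarith [hc.1])).comp
        (hx.comp (tendsto_add_atTop_nat n₀))
  rw [tendstoInMeasure_iff_dist] at key
  have := key ε hε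
  refine this.congr fun n => ?_
  simp only [Real.dist_eq, Function.comp]
  rw [Measure.restrict_apply' measurableSet_Icc, inter_comm]
  rfl

/-- The uniform convergence theorem. -/
theorem uniform (hf : SlowlyVarying f) {ε : ℝ} (hε : 0 < ε) :
    ∃ T > 0, ∀ t ≥ T, 0 < f t ∧ ∀ c ∈ Icc (1 : ℝ) 2, |f (c * t) / f t - 1| < ε := by
  -- At the end `z = f(ct)/f(t)` and `w = f(st)/f(ct)` satisfy `|zw - 1| < δ` and `|w - 1| < δ`,
  -- whence `|z - 1| < 2δ/(1-δ) < 4δ`.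
  obtain ⟨δ, hδ, hδ1, hδε⟩ : ∃ δ > 0, δ < 1 / 2 ∧ 4 * δ < ε := by
    refine ⟨min (1 / 4) (ε / 8), by positivity, ?_, ?_⟩
    · exact (min_le_left _ _).trans_lt (by norm_num)
    · linarith [min_le_right (1 / 4 : ℝ) (ε / 8)]
  have h1 := (tendsto_measure_exceptional hf hδ).eventually_lt_const
    (show (0 : ENNReal) < ENNReal.ofReal (1 / 2) by simp)
  obtain ⟨T, hT⟩ := eventually_atTop.1 (h1.and (hf.eventually_pos.and (eventually_gt_atTop 0)))
  refine ⟨max T 1, by positivity, fun t ht => ?_⟩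
  have hTt : T ≤ t := (le_max_left _ _).trans ht
  refine ⟨(hT t hTt).2.1, fun c hc => ?_⟩
  have ht0 : 0 < t := (hT t hTt).2.2
  have hc0 : 0 < c := by linarith [hc.1]
  have hct : T ≤ c * t := hTt.trans (by nlinarith [hc.1])
  set E := fun x => {c ∈ Icc (1 : ℝ) 4 | δ ≤ |f (c * x) / f x - 1|} with hE
  -- a common good point
  obtain ⟨s, hs, hs1, hs2⟩ : ∃ s ∈ Icc (2 : ℝ) 4, s ∉ E t ∧ s / c ∉ E (c * t) := by
    -- The interval `[2, 4]` has length `2`. The points bad for `t` have measure below `1/2`, and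
    -- those bad for `c t`, dilated by `c ≤ 2`, have measure at most `1`. For `s ∈ [2, 4]` and `c ∈
    -- [1, 2]` the quotient `s / c` stays in `[1, 4]`.
    by_contra! hcon
    have hsub : Icc (2 : ℝ) 4 ⊆ E t ∪ (fun s => s * c⁻¹) ⁻¹' E (c * t) := by
      intro s hs
      by_cases h : s ∈ E t
      · exact Or.inl h
      · exact Or.inr (by simpa [div_eq_mul_inv] using hcon s hs h)
    have hle := (measure_mono (μ := volume) hsub).trans (measure_union_le _ _)
    rw [Real.volume_preimage_mul_right (inv_ne_zero hc0.ne'), inv_inv, abs_of_pos hc0,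
      Real.volume_Icc] at hle
    have hA : volume (E t) < ENNReal.ofReal (1 / 2) := (hT t hTt).1
    have hB : volume (E (c * t)) < ENNReal.ofReal (1 / 2) := (hT _ hct).1
    have : ENNReal.ofReal c * volume (E (c * t)) ≤ ENNReal.ofReal 2 * ENNReal.ofReal (1 / 2) := by
      gcongr
      exact hc.2
    have h2 := hle.trans (add_le_add hA.le this)
    rw [← ENNReal.ofReal_mul (by norm_num), ← ENNReal.ofReal_add (by norm_num) (by norm_num)] at h2
    rw [ENNReal.ofReal_le_ofReal_iff (by norm_num)] at h2
    norm_num at h2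
  have ha : |f (s * t) / f t - 1| < δ := by
    by_contra! h
    exact hs1 ⟨⟨by linarith [hs.1], hs.2⟩, h⟩
  have hb : |f (s * t) / f (c * t) - 1| < δ := by
    by_contra! h
    refine hs2 ⟨⟨?_, ?_⟩, ?_⟩
    · rw [le_div_iff₀ hc0]; linarith [hs.1, hc.2]
    · rw [div_le_iff₀ hc0]; linarith [hs.2, hc.1]
    · rwa [show s / c * (c * t) = s * t by field_simp]
  have hp : 0 < f t := (hT t hTt).2.1
  have hq : 0 < f (c * t) := (hT _ hct).2.1
  rw [abs_lt] at ha hb ⊢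
  have e1 : f (s * t) / f t = f (c * t) / f t * (f (s * t) / f (c * t)) := by
    rw [div_mul_div_comm, mul_comm (f (c * t)), mul_div_mul_right _ _ hq.ne']
  have hz : 0 < f (c * t) / f t := by positivity
  rw [e1] at ha
  generalize f (c * t) / f t = z at *
  generalize f (s * t) / f (c * t) = w at *
  constructor <;> nlinarith

/-- Potter bounds. -/
theorem potter (hf : SlowlyVarying f) {δ : ℝ} (hδ : 0 < δ) :
    ∃ T > 0, (∀ t ≥ T, 0 < f t) ∧ ∀ t ≥ T, ∀ c : ℝ, 1 ≤ c →
      f (c * t) ≤ 2 ^ δ * c ^ δ * f t ∧ f t ≤ 2 ^ δ * c ^ δ * f (c * t) := by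
  have h2 : (1 : ℝ) < 2 ^ δ := Real.one_lt_rpow (by norm_num) hδ
  set A : ℝ := 2 ^ δ
  -- This tolerance confines the ratio to `(A⁻¹, 2 - A⁻¹)`, and `2 - A⁻¹ ≤ A`.
  obtain ⟨T, hT0, hT⟩ := hf.uniform (ε := 1 - A⁻¹) (by
    rw [sub_pos]; exact inv_lt_one_of_one_lt₀ h2)
  have hAi : A * A⁻¹ = 1 := mul_inv_cancel₀ (by positivity)
  have base : ∀ t ≥ T, ∀ c ∈ Icc (1 : ℝ) 2, f (c * t) ≤ A * f t ∧ f t ≤ A * f (c * t) := by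
    intro t ht c hc
    obtain ⟨hp, hu⟩ := hT t ht
    have := abs_lt.1 (hu c hc)
    have e : f (c * t) = f (c * t) / f t * f t := by field_simp
    rw [e]
    generalize f (c * t) / f t = z at *
    have hA0 : 0 < A := by linarith
    have hAi0 : 0 < A⁻¹ := by positivity
    constructor
    · have : z ≤ A := by nlinarith [sq_nonneg (A - 1)]
      gcongr
    · have : 1 ≤ A * z := by nlinarith
      nlinarith
  refine ⟨T, hT0, fun t ht => (hT t ht).1, ?_⟩
  -- Each halving of `c` costs a factor `A = 2 ^ δ`, which is exactly `c ^ δ / (c / 2) ^ δ`; hence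
  -- the leading constant does not grow with `k`.
  have step : ∀ k : ℕ, ∀ t ≥ T, ∀ c : ℝ, 1 ≤ c → c ≤ 2 ^ k →
      f (c * t) ≤ A * c ^ δ * f t ∧ f t ≤ A * c ^ δ * f (c * t) := by
    intro k
    induction k with
    | zero =>
      intro t ht c h1 hc
      have : c = 1 := le_antisymm (by simpa using hc) h1
      subst this
      have := (hT t ht).1
      simp only [one_mul, Real.one_rpow, mul_one]
      constructor <;> nlinarith
    | succ k ih =>
      intro t ht c h1 hc
      have hp := (hT t ht).1
      have ht0 : 0 < t := hT0.trans_le ht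
      by_cases hc2 : c ≤ 2
      · have hb := base t ht c ⟨h1, hc2⟩
        have hcd : 1 ≤ c ^ δ := Real.one_le_rpow h1 hδ.le
        have hp' := (hT (c * t) (by nlinarith [hT0])).1
        constructor
        · refine hb.1.trans ?_
          gcongr
          nlinarith
        · refine hb.2.trans ?_
          gcongr
          nlinarith
      · push Not at hc2
        obtain ⟨i1, i2⟩ := ih t ht (c / 2) (by linarith) (by rw [pow_succ] at hc; linarith)
        have htt : T ≤ c / 2 * t := by nlinarith
        obtain ⟨b1, b2⟩ := base (c / 2 * t) htt 2 (by norm_num)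
        rw [show 2 * (c / 2 * t) = c * t by ring] at b1 b2
        have e : c ^ δ = A * (c / 2) ^ δ := by
          rw [← Real.mul_rpow (by norm_num) (by linarith)]; congr 1; ring
        rw [e]
        have hpw : 0 < (c / 2) ^ δ := Real.rpow_pos_of_pos (by linarith) _
        constructor
        · calc f (c * t) ≤ A * f (c / 2 * t) := b1
            _ ≤ A * (A * (c / 2) ^ δ * f t) := by gcongr
            _ = _ := by ring
        · calc f t ≤ A * (c / 2) ^ δ * f (c / 2 * t) := i2
            _ ≤ A * (c / 2) ^ δ * (A * f (c * t)) := by gcongr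
            _ = _ := by ring
  intro t ht c hc
  obtain ⟨k, hk⟩ := pow_unbounded_of_one_lt c (show (1 : ℝ) < 2 by norm_num)
  exact step k t ht c hc hk.le

/-- The power growth `t ^ α * f t` exceeds a multiple of any smaller power. -/
theorem exists_rpow_le (hf : SlowlyVarying f) {α β : ℝ} (hβ : β < α) :
    ∃ κ > 0, ∃ T > 0, ∀ t ≥ T, 0 < f t ∧ κ * t ^ β ≤ t ^ α * f t := by
  obtain ⟨T, hT0, hpos, hT⟩ := hf.potter (sub_pos.2 hβ)
  have hfT := hpos T le_rfl
  refine ⟨f T * T ^ (α - β) / 2 ^ (α - β), by positivity, T, hT0, fun t ht => ⟨hpos t ht, ?_⟩⟩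
  have ht0 : 0 < t := hT0.trans_le ht
  have h := (hT T le_rfl (t / T) ((one_le_div hT0).2 ht)).2
  rw [div_mul_cancel₀ _ hT0.ne', Real.div_rpow ht0.le hT0.le] at h
  have e : t ^ α = t ^ (α - β) * t ^ β := by rw [← Real.rpow_add ht0]; congr 1; ring
  rw [e]
  have hT' : 0 < T ^ (α - β) := by positivity
  have h2' : (0 : ℝ) < 2 ^ (α - β) := by positivity
  have : f T * T ^ (α - β) / 2 ^ (α - β) ≤ t ^ (α - β) * f t := by
    rw [div_le_iff₀ h2']
    calc f T * T ^ (α - β) ≤ (2 ^ (α - β) * (t ^ (α - β) / T ^ (α - β)) * f t) * T ^ (α - β) := by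
          gcongr
      _ = _ := by field_simp
  calc f T * T ^ (α - β) / 2 ^ (α - β) * t ^ β ≤ t ^ (α - β) * f t * t ^ β := by gcongr
    _ = _ := by ring

/-- The uniform convergence theorem, along a filter. -/
theorem tendsto_ratio (hf : SlowlyVarying f) {ι : Type*} {F : Filter ι} {s t : ι → ℝ}
    (ht : Tendsto t F atTop) (hst : ∀ᶠ i in F, t i ≤ s i)
    (hr : Tendsto (fun i => s i / t i) F (𝓝 1)) :
    Tendsto (fun i => f (s i) / f (t i)) F (𝓝 1) := by
  rw [Metric.tendsto_nhds]
  intro ε hε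
  obtain ⟨T, hT0, hT⟩ := hf.uniform hε
  filter_upwards [ht.eventually_ge_atTop T, hst, hr.eventually_le_const (show (1 : ℝ) < 2 by norm_num)]
    with i h1 h2 h3
  have hti : 0 < t i := hT0.trans_le h1
  have := (hT _ h1).2 (s i / t i) ⟨(one_le_div hti).2 h2, h3⟩
  rwa [div_mul_cancel₀ _ hti.ne'] at this

end SlowlyVarying

/-! ### Order statistics and the limit of the mean for `α < s + 1` -/

/-- The density at `x` of the position of the `(s + 1)`-st smallest of `n` uniform points. -/
noncomputable def orderDensity (n s : ℕ) (x : ℝ) : ℝ :=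
  n * ((n - 1).choose s * x ^ s * (1 - x) ^ (n - 1 - s))

theorem orderDensity_nonneg (n s : ℕ) {x : ℝ} (h0 : 0 ≤ x) (h1 : x ≤ 1) :
    0 ≤ orderDensity n s x := by
  have : 0 ≤ 1 - x := by linarith
  unfold orderDensity
  positivity

theorem continuous_orderDensity (n s : ℕ) : Continuous (orderDensity n s) := by
  unfold orderDensity
  fun_prop

/-- Domination uniform in `n`: the binomial coefficient is at most `n ^ s`, which cancels the
denominators, and `n - 1 - s ≥ n / 2` leaves half of the exponential decay. -/
theorem choose_mul_pow_le_exp {n s : ℕ} (hn : 2 * (s + 1) ≤ n) {y : ℝ} (h0 : 0 ≤ y) (h1 : y ≤ n) :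
    (n - 1).choose s * (y / n) ^ s * (1 - y / n) ^ (n - 1 - s) ≤ y ^ s * Real.exp (-y / 2) := by
  have hn0 : (0 : ℝ) < n := by exact_mod_cast (by omega : 0 < n)
  have hyn : 0 ≤ 1 - y / n := by rw [sub_nonneg]; exact (div_le_one hn0).2 h1
  have hc : ((n - 1).choose s : ℝ) ≤ (n : ℝ) ^ s := by
    have := Nat.choose_le_pow_div (α := ℝ) s (n - 1)
    refine this.trans ((div_le_self (by positivity) ?_).trans ?_)
    · exact_mod_cast Nat.one_le_iff_ne_zero.2 (Nat.factorial_ne_zero s)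
    · gcongr; exact_mod_cast Nat.sub_le n 1
  have hexp : (1 - y / n) ^ (n - 1 - s) ≤ Real.exp (-y / 2) := by
    have h2 : 1 - y / n ≤ Real.exp (-(y / n)) := by
      have := Real.add_one_le_exp (-(y / n)); linarith
    calc (1 - y / n) ^ (n - 1 - s) ≤ Real.exp (-(y / n)) ^ (n - 1 - s) := by gcongr
      _ = Real.exp ((n - 1 - s : ℕ) * -(y / n)) := by rw [← Real.exp_nat_mul]
      _ ≤ Real.exp (-y / 2) := by
        apply Real.exp_le_exp.2
        have hk : (n : ℝ) ≤ 2 * ((n - 1 - s : ℕ) : ℝ) := by exact_mod_cast (by omega)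
        have e : y / 2 = n / 2 * (y / n) := by field_simp
        have hq : 0 ≤ y / n := by positivity
        nlinarith
  calc ((n - 1).choose s : ℝ) * (y / n) ^ s * (1 - y / n) ^ (n - 1 - s)
      ≤ (n : ℝ) ^ s * (y / n) ^ s * Real.exp (-y / 2) := by gcongr
    _ = y ^ s * Real.exp (-y / 2) := by rw [← mul_pow, mul_div_cancel₀ _ hn0.ne']

/-- Poisson limit of the binomial law with `n - 1` trials and success probability `y / n`. -/
theorem tendsto_choose_mul_pow_exp (s : ℕ) (y : ℝ) :
    Tendsto (fun n : ℕ => (n - 1).choose s * (y / n) ^ s * (1 - y / n) ^ (n - 1 - s)) atTop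
      (𝓝 (Real.exp (-y) * y ^ s / s.factorial)) := by
  rw [← tendsto_add_atTop_iff_nat 1]
  have := tendsto_choose_mul_pow_of_tendsto_mul_atTop (p := fun n : ℕ => y / (n + 1)) (r := y) s
    (by
      have := (tendsto_natCast_div_add_atTop (1 : ℝ)).mul_const y
      rw [one_mul] at this
      refine this.congr fun n => ?_
      ring)
  simpa using this

/-- A bound for a scaled counting function that does not depend on the scale. -/
theorem exists_scaled_bound {l N : ℝ → ℝ} (hl : SlowlyVarying l) {α lam δ : ℝ} (hα : 0 < α)
    (hlam : 0 ≤ lam) (hδ : 0 < δ)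
    (hN : AntitoneOn N (Ioi 0))
    (hlim : Tendsto (fun x : ℝ => N x / (l (1 / x) * x ^ (-α))) (𝓝[>] 0) (𝓝 lam)) :
    ∃ C > 0, ∃ T > 0, ∀ t ≥ T, 0 < l t ∧ ∀ y > 0, 
      N (y / t) / (t ^ α * l t) ≤ C * (y ^ (-α + δ) + y ^ (-α - δ) + 1) := by
  obtain ⟨T, hT0, hpos, hT⟩ := hl.potter hδ
  obtain ⟨κ, hκ, T', hT'0, hT'⟩ := hl.exists_rpow_le hα
  have h1 := hlim.eventually_le_const (lt_add_one lam)
  rw [eventually_nhdsWithin_iff, Metric.eventually_nhds_iff] at h1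
  obtain ⟨x₀, hx₀, h1⟩ := h1
  obtain ⟨x₁, hx₁, hx₁', hx₁T⟩ : ∃ x₁ > 0, x₁ < x₀ ∧ x₁ ≤ 1 / T :=
    ⟨min (x₀ / 2) (1 / T), by positivity, (min_le_left _ _).trans_lt (by linarith),
      min_le_right _ _⟩
  refine ⟨(lam + 1) * 2 ^ δ + |N x₁| / κ, by positivity, max T T', lt_max_of_lt_left hT0,
    fun t ht => ?_⟩
  have htT : T ≤ t := (le_max_left _ _).trans ht
  have htT' : T' ≤ t := (le_max_right _ _).trans ht
  have ht0 : 0 < t := hT0.trans_le htT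
  have hlt := hpos t htT
  refine ⟨hlt, fun y hy => ?_⟩
  have hA : 0 < y ^ (-α + δ) := by positivity
  have hB : 0 < y ^ (-α - δ) := by positivity
  have hs : 0 ≤ |N x₁| / κ := by positivity
  -- For small `y / t` the hypothesis on `N` applies, and Potter bounds compare `l (t / y)` with `l
  -- t`, in one direction for `y ≥ 1` and in the other for `y ≤ 1`. Otherwise monotonicity bounds
  -- `N` by `N x₁` while `t ^ α * l t ≥ κ`; this accounts for the summand `1`.
  by_cases hyt : y / t ≤ x₁
  · have hyt0 : 0 < y / t := by positivity
    have hty : T ≤ t / y := by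
      rw [← inv_div, le_inv_comm₀ hT0 hyt0, ← one_div]
      exact hyt.trans hx₁T
    have hl2 := hpos _ hty
    have hq := h1 (y := y / t) (by rw [Real.dist_eq, sub_zero, abs_of_pos hyt0]; linarith) hyt0
    rw [one_div_div, div_le_iff₀ (by positivity)] at hq
    have hpot : l (t / y) ≤ 2 ^ δ * (y ^ δ + y ^ (-δ)) * l t := by
      rcases le_total 1 y with h | h
      · have := (hT _ hty y h).2
        rw [mul_div_cancel₀ _ hy.ne'] at this
        refine this.trans ?_
        gcongr
        exact le_add_of_nonneg_right (by positivity)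
      · have := (hT _ htT y⁻¹ ((one_le_inv₀ hy).2 h)).1
        rw [show y⁻¹ * t = t / y by ring, Real.inv_rpow hy.le, ← Real.rpow_neg hy.le] at this
        refine this.trans ?_
        gcongr
        exact le_add_of_nonneg_left (by positivity)
    have e : (y / t) ^ (-α) = y ^ (-α) * t ^ α := by
      rw [Real.div_rpow hy.le ht0.le, Real.rpow_neg ht0.le, div_inv_eq_mul]
    rw [div_le_iff₀ (by positivity)]
    calc N (y / t) ≤ (lam + 1) * (l (t / y) * (y ^ (-α) * t ^ α)) := by rw [← e]; exact hq
      _ ≤ (lam + 1) * (2 ^ δ * (y ^ δ + y ^ (-δ)) * l t * (y ^ (-α) * t ^ α)) := by gcongr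
      _ = (lam + 1) * 2 ^ δ * (y ^ (-α + δ) + y ^ (-α - δ)) * (t ^ α * l t) := by
        rw [Real.rpow_add hy, Real.rpow_sub hy, Real.rpow_neg hy.le δ]; ring
      _ ≤ _ := mul_le_mul_of_nonneg_right (mul_le_mul (le_add_of_nonneg_right hs) (by linarith)
          (by positivity) (by positivity)) (by positivity)
  · push Not at hyt
    have h3 : N (y / t) ≤ |N x₁| := (hN hx₁ (hx₁.trans hyt) hyt.le).trans (le_abs_self _)
    have h4 := (hT' t htT').2
    rw [Real.rpow_zero, mul_one] at h4
    calc N (y / t) / (t ^ α * l t) ≤ |N x₁| / (t ^ α * l t) := by gcongr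
      _ ≤ |N x₁| / κ := by gcongr
      _ ≤ ((lam + 1) * 2 ^ δ + |N x₁| / κ) * 1 := by
        rw [mul_one]; exact le_add_of_nonneg_left (by positivity)
      _ ≤ _ := by gcongr; linarith

/-- The hypothesis at `x = y / t` normalises by `l (t / y)`; slow variation replaces it by `l t`. -/
theorem tendsto_scaled {l N : ℝ → ℝ} (hl : SlowlyVarying l) {α lam : ℝ}
    (hlim : Tendsto (fun x : ℝ => N x / (l (1 / x) * x ^ (-α))) (𝓝[>] 0) (𝓝 lam))
    {y : ℝ} (hy : 0 < y) :
    Tendsto (fun t : ℝ => N (y / t) / (t ^ α * l t)) atTop (𝓝 (lam * y ^ (-α))) := by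
  have h1 : Tendsto (fun t : ℝ => y / t) atTop (𝓝[>] 0) := by
    rw [tendsto_nhdsWithin_iff]
    refine ⟨tendsto_const_nhds.div_atTop tendsto_id, ?_⟩
    filter_upwards [eventually_gt_atTop 0] with t ht using div_pos hy ht
  have h2 := (hlim.comp h1).mul ((hl.2 y⁻¹ (by positivity)).mul_const (y ^ (-α)))
  rw [one_mul] at h2
  refine h2.congr' ?_
  have hinf : Tendsto (fun t : ℝ => y⁻¹ * t) atTop atTop :=
    tendsto_id.const_mul_atTop (by positivity)
  filter_upwards [eventually_gt_atTop 0, hinf.eventually hl.eventually_pos, hl.eventually_pos]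
    with t ht hp hp'
  simp only [Function.comp]
  rw [one_div_div, show y⁻¹ * t = t / y by ring, Real.div_rpow hy.le ht.le, Real.rpow_neg ht.le,
    div_inv_eq_mul]
  rw [show y⁻¹ * t = t / y by ring] at hp
  have hya : 0 < y ^ (-α) := by positivity
  have hta : 0 < t ^ α := by positivity
  field_simp

theorem integral_Ioc_eq_integral_scaled (g : ℝ → ℝ) {n : ℕ} (hn : 0 < n) :
    ∫ x in Ioc (0 : ℝ) 1, g x
      = ∫ y in Ioi (0 : ℝ), (Ioc (0 : ℝ) n).indicator (fun y => (n : ℝ)⁻¹ * g (y / n)) y := by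
  have hn' : (0 : ℝ) < n := by exact_mod_cast hn
  rw [setIntegral_indicator measurableSet_Ioc, inter_eq_right.2 Ioc_subset_Ioi_self,
    ← intervalIntegral.integral_of_le (by norm_num), ← intervalIntegral.integral_of_le hn'.le,
    intervalIntegral.integral_const_mul, intervalIntegral.integral_comp_div _ hn'.ne']
  simp [hn'.ne']

theorem tendsto_integral_orderDensity {l N : ℝ → ℝ} (hl : SlowlyVarying l) {α lam : ℝ} {s : ℕ}
    (hα : 0 < α) (hαs : α < s + 1) (hlam : 0 ≤ lam)
    (hN : AntitoneOn N (Ioi 0)) (hN0 : ∀ x > 0, 0 ≤ N x)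
    (hlim : Tendsto (fun x : ℝ => N x / (l (1 / x) * x ^ (-α))) (𝓝[>] 0) (𝓝 lam)) :
    Tendsto (fun n : ℕ => (∫ x in Ioc (0 : ℝ) 1, N x * orderDensity n s x) / ((n : ℝ) ^ α * l n))
      atTop (𝓝 (Real.Gamma (s + 1 - α) / s.factorial * lam)) := by
  -- The Potter loss `δ` must keep the worst exponent at the origin, `s - α - δ`, above `-1`.
  obtain ⟨δ, hδ, hδs⟩ : ∃ δ > 0, δ < s + 1 - α :=
    ⟨(s + 1 - α) / 2, by linarith, by linarith⟩
  obtain ⟨C, hC, T, hT0, hT⟩ := exists_scaled_bound hl hα hlam hδ hN hlim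
  have hlimit : Real.Gamma (s + 1 - α) / s.factorial * lam
      = ∫ y in Ioi (0 : ℝ), lam * y ^ (-α) * (Real.exp (-y) * y ^ s / s.factorial) := by
    rw [Real.Gamma_eq_integral (by linarith), div_mul_eq_mul_div, mul_comm _ lam, mul_div_assoc,
      ← integral_div, ← integral_const_mul]
    refine setIntegral_congr_fun measurableSet_Ioi fun y hy => ?_
    have hy : 0 < y := hy
    rw [show (s : ℝ) + 1 - α - 1 = -α + s by ring, Real.rpow_add hy, Real.rpow_natCast]
    ring
  rw [hlimit]
  have hev : ∀ᶠ n : ℕ in atTop, 2 * (s + 1) ≤ n ∧ T ≤ n :=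
    (eventually_ge_atTop _).and (tendsto_natCast_atTop_atTop.eventually_ge_atTop T)
  have heq : ∀ᶠ n : ℕ in atTop,
      ∫ y in Ioi (0 : ℝ), (Ioc (0 : ℝ) n).indicator (fun y => N (y / n) / ((n : ℝ) ^ α * l n) *
        ((n - 1).choose s * (y / n) ^ s * (1 - y / n) ^ (n - 1 - s))) y
      = (∫ x in Ioc (0 : ℝ) 1, N x * orderDensity n s x) / ((n : ℝ) ^ α * l n) := by
    filter_upwards [hev] with n hn
    have hn0 : 0 < n := by omega
    have hn' : (0 : ℝ) < n := by exact_mod_cast hn0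
    rw [integral_Ioc_eq_integral_scaled _ hn0, ← integral_div]
    refine integral_congr_ae (Eventually.of_forall fun y => ?_)
    simp only [indicator_apply]
    split_ifs
    · unfold orderDensity
      field_simp
    · simp
  refine Tendsto.congr' heq ?_
  refine tendsto_integral_filter_of_dominated_convergence
    (fun y => C * (y ^ (-α + δ) + y ^ (-α - δ) + 1) * (y ^ s * Real.exp (-y / 2))) ?_ ?_ ?_ ?_
  · filter_upwards [hev] with n hn
    have hn' : (0 : ℝ) < n := by exact_mod_cast (by omega : 0 < n)
    have hanti : AntitoneOn (fun y => N (y / n)) (Ioi 0) := fun a ha b hb hab =>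
      hN (div_pos ha hn') (div_pos hb hn') (by gcongr)
    have hm := aemeasurable_restrict_of_antitoneOn (μ := volume) measurableSet_Ioi hanti
    refine ((hm.div_const _).aestronglyMeasurable.mul ?_).indicator measurableSet_Ioc
    exact Continuous.aestronglyMeasurable (by fun_prop)
  · filter_upwards [hev] with n hn
    filter_upwards [ae_restrict_mem measurableSet_Ioi] with y hy
    have hy : 0 < y := hy
    have hn' : (0 : ℝ) < n := by exact_mod_cast (by omega : 0 < n)
    have hb := hT n hn.2
    rw [indicator_apply]
    split_ifs with hyn
    · have h1 : 0 ≤ N (y / n) / ((n : ℝ) ^ α * l n) := by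
        have := hN0 (y / n) (by positivity)
        have := hb.1
        positivity
      have h2 : 0 ≤ 1 - y / n := by rw [sub_nonneg]; exact (div_le_one hn').2 hyn.2
      rw [Real.norm_of_nonneg (by positivity)]
      exact mul_le_mul (hb.2 y hy) (choose_mul_pow_le_exp hn.1 hy.le hyn.2) (by positivity)
        (h1.trans (hb.2 y hy))
    · rw [norm_zero]
      positivity
  · have aux : ∀ q : ℝ, -1 < q → IntegrableOn (fun y : ℝ => y ^ q * Real.exp (-y / 2)) (Ioi 0) := by
      intro q hq
      have := integrableOn_rpow_mul_exp_neg_mul_rpow (p := 1) (s := q) (b := 1 / 2) hq one_pos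
        (by norm_num)
      refine this.congr_fun (fun y _ => ?_) measurableSet_Ioi
      simp only [Real.rpow_one]
      congr 2; ring
    have h := (((aux (-α + δ + s) (by linarith)).add (aux (-α - δ + s) (by linarith))).add
      (aux s (by linarith [(Nat.cast_nonneg s : (0 : ℝ) ≤ s)]))).const_mul C
    refine IntegrableOn.congr_fun h (fun y hy => ?_) measurableSet_Ioi
    have hy : 0 < y := hy
    simp only [Pi.add_apply]
    rw [Real.rpow_add hy (-α + δ), Real.rpow_add hy (-α - δ), Real.rpow_natCast]
    ring
  · filter_upwards [ae_restrict_mem measurableSet_Ioi] with y hy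
    have hy : 0 < y := hy
    have := ((tendsto_scaled hl hlim hy).comp tendsto_natCast_atTop_atTop).mul
      (tendsto_choose_mul_pow_exp s y)
    refine this.congr' ?_
    filter_upwards [tendsto_natCast_atTop_atTop.eventually_ge_atTop y] with n hn
    rw [indicator_of_mem (show y ∈ Ioc (0 : ℝ) n from ⟨hy, hn⟩)]
    rfl

/-! ### The function `ℓ^*` and its Abelian theorem -/

/-- The integrand of `ℓ^*(t)` after the substitution `s = t y`. -/
noncomputable def starKernel (h : ℝ → ℝ) (t s : ℝ) : ℝ :=
  Real.exp (-(t / s)) / s * h s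

theorem starIntegrand_eq (l : ℝ → ℝ) {t y : ℝ} (ht : 0 < t) :
    starIntegrand l t y = t * starKernel l t (t * y) := by
  unfold starIntegrand starKernel
  rcases eq_or_ne y 0 with rfl | hy
  · simp
  · rw [show t / (t * y) = 1 / y by field_simp]
    field_simp

theorem integrableOn_starIntegrand_iff (l : ℝ → ℝ) {t : ℝ} (ht : 0 < t) :
    IntegrableOn (starIntegrand l t) (Ioi 0) ↔ IntegrableOn (starKernel l t) (Ioi 0) := by
  have h := integrableOn_Ioi_comp_mul_left_iff (starKernel l t) 0 ht
  rw [mul_zero] at h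
  rw [← h, show starIntegrand l t = fun y => t * starKernel l t (t * y) from
    funext fun y => starIntegrand_eq l ht]
  unfold IntegrableOn
  exact integrable_const_mul_iff (by simpa using ht.ne') _

theorem lstar_eq (l : ℝ → ℝ) {t : ℝ} (ht : 0 < t) :
    lstar l t = ∫ s in Ioi (0 : ℝ), starKernel l t s := by
  have h := integral_comp_mul_left_Ioi (starKernel l t) 0 ht
  rw [mul_zero] at h
  unfold lstar
  rw [funext fun y => starIntegrand_eq l (y := y) ht, integral_const_mul, h, smul_eq_mul,
    mul_inv_cancel_left₀ ht.ne']

/-- For `t ≥ t₀` the extra factor is at most `1`, and it is exponentially small in `t` on bounded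
ranges of `s > 0`. All dominations of the kernel come from this. -/
theorem starKernel_eq_mul (h : ℝ → ℝ) (t₀ t s : ℝ) :
    starKernel h t s = starKernel h t₀ s * Real.exp (-((t - t₀) / s)) := by
  unfold starKernel
  rw [show -(t / s) = -(t₀ / s) + -((t - t₀) / s) by ring, Real.exp_add]
  ring

theorem norm_starKernel_le (h : ℝ → ℝ) {t₀ t s : ℝ} (hs : 0 < s) (ht : t₀ ≤ t) :
    ‖starKernel h t s‖ ≤ ‖starKernel h t₀ s‖ := by
  rw [starKernel_eq_mul h t₀, norm_mul]
  refine mul_le_of_le_one_right (norm_nonneg _) ?_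
  rw [Real.norm_of_nonneg (Real.exp_nonneg _)]
  apply Real.exp_le_one_iff.2
  have : 0 ≤ (t - t₀) / s := div_nonneg (by linarith) hs.le
  linarith

theorem integrableOn_starKernel_mono {h : ℝ → ℝ} {t₀ t : ℝ} (ht : t₀ ≤ t)
    (hi : IntegrableOn (starKernel h t₀) (Ioi 0)) : IntegrableOn (starKernel h t) (Ioi 0) := by
  refine Integrable.mono hi ?_ ?_
  · rw [funext fun s => starKernel_eq_mul h t₀ t s]
    exact hi.aestronglyMeasurable.mul (Measurable.aestronglyMeasurable (by fun_prop))
  · filter_upwards [ae_restrict_mem measurableSet_Ioi] with s hs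
    exact norm_starKernel_le h hs ht

/-- On `(0, S]` nothing is known about `h` except integrability, not even its sign. The bound decays
exponentially in `t`, so this range does not affect the asymptotics. -/
theorem abs_setIntegral_starKernel_le {h : ℝ → ℝ} {t₀ t S : ℝ} (ht : t₀ ≤ t)
    (hi : IntegrableOn (starKernel h t₀) (Ioi 0)) :
    |∫ s in Ioc 0 S, starKernel h t s|
      ≤ Real.exp (-((t - t₀) / S)) * ∫ s in Ioi 0, ‖starKernel h t₀ s‖ := by
  have h1 : |∫ s in Ioc 0 S, starKernel h t s|
      ≤ ∫ s in Ioc 0 S, Real.exp (-((t - t₀) / S)) * ‖starKernel h t₀ s‖ := by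
    rw [← Real.norm_eq_abs]
    refine norm_integral_le_of_norm_le
      ((hi.mono_set Ioc_subset_Ioi_self).norm.const_mul _) ?_
    filter_upwards [ae_restrict_mem measurableSet_Ioc] with s hs
    rw [starKernel_eq_mul h t₀, norm_mul, mul_comm, Real.norm_of_nonneg (Real.exp_nonneg _)]
    refine mul_le_mul_of_nonneg_right (Real.exp_le_exp.2 (neg_le_neg ?_)) (norm_nonneg _)
    exact div_le_div_of_nonneg_left (by linarith) hs.1 hs.2
  rw [integral_const_mul] at h1
  refine h1.trans ?_
  gcongr
  · filter_upwards with s using norm_nonneg _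
  · exact hi.norm
  · exact Ioc_subset_Ioi_self

theorem integral_Ioi_starKernel_split {h : ℝ → ℝ} {t S : ℝ} (hS : 0 < S)
    (hi : IntegrableOn (starKernel h t) (Ioi 0)) :
    ∫ s in Ioi 0, starKernel h t s
      = (∫ s in Ioc 0 S, starKernel h t s) + ∫ s in Ioi S, starKernel h t s := by
  rw [← setIntegral_union (Ioc_disjoint_Ioi le_rfl) measurableSet_Ioi
    (hi.mono_set Ioc_subset_Ioi_self) (hi.mono_set (Ioi_subset_Ioi hS.le)), Ioc_union_Ioi_eq_Ioi hS.le]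

/-- A slowly varying function is eventually at least `κ / t`, which an exponential beats. -/
theorem SlowlyVarying.tendsto_exp_div {l : ℝ → ℝ} (hl : SlowlyVarying l) {a : ℝ} (ha : 0 < a)
    (b : ℝ) : Tendsto (fun t => Real.exp (-((t - b) / a)) / l t) atTop (𝓝 0) := by
  obtain ⟨κ, hκ, T, hT0, hT⟩ := hl.exists_rpow_le (show (0 : ℝ) < 1 by norm_num)
  have h1 : Tendsto (fun t : ℝ => Real.exp (b / a) / κ * (t ^ (1 : ℝ) * Real.exp (-(1 / a) * t)))
      atTop (𝓝 0) := by
    simpa using (tendsto_rpow_mul_exp_neg_mul_atTop_nhds_zero 1 (1 / a)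
      (by positivity)).const_mul (Real.exp (b / a) / κ)
  refine squeeze_zero' ?_ ?_ h1
  · filter_upwards [eventually_ge_atTop T] with t ht
    have := (hT t ht).1
    positivity
  · filter_upwards [eventually_ge_atTop T] with t ht
    obtain ⟨hp, hq⟩ := hT t ht
    rw [Real.rpow_zero, mul_one] at hq
    rw [show -((t - b) / a) = b / a + -(1 / a) * t by ring, Real.exp_add, div_le_iff₀ hp]
    rw [div_mul_eq_mul_div, div_mul_eq_mul_div, le_div_iff₀ hκ]
    calc Real.exp (b / a) * Real.exp (-(1 / a) * t) * κ
        ≤ Real.exp (b / a) * Real.exp (-(1 / a) * t) * (t ^ (1 : ℝ) * l t) := by gcongr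
      _ = _ := by ring

/-- The values of `ℓ` are bounded by those of `ℓ^*`, and by the increments of `ℓ^*`. -/
theorem exists_mul_le_lstar_sub {l : ℝ → ℝ} (hl : SlowlyVarying l) {t₀ : ℝ}
    (hi : IntegrableOn (starKernel l t₀) (Ioi 0)) {b : ℝ} (hb0 : 0 ≤ b) (hb1 : b ≤ 1) :
    ∃ κ > 0, ∀ᶠ t in atTop, κ * l t ≤ lstar l t - b * lstar l (2 * t) := by
  obtain ⟨T, hT0, hT⟩ := hl.uniform (show (0 : ℝ) < 1 / 2 by norm_num)
  set B := ∫ s in Ioi 0, ‖starKernel l t₀ s‖ with hB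
  have hB0 : 0 ≤ B := integral_nonneg fun _ => norm_nonneg _
  -- Only `s ∈ (t, 2t]` is kept. There `e^{-t/s} ≥ e^{-1}`, `1 - b e^{-t/s} ≥ 1 - e^{-1/2}`, `l s ≥
  -- l t / 2` and `1 / s ≥ 1 / (2t)`; the length `t` of the interval then gives the factor `1 / 4`.
  -- The other half of `κ` pays for the integrals over `(0, T]`.
  set κ : ℝ := Real.exp (-1) * (1 - Real.exp (-(1 / 2))) / 4 with hκ
  have hκ0 : 0 < κ := by
    have : Real.exp (-(1 / 2)) < 1 := Real.exp_lt_one_iff.2 (by norm_num)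
    have : 0 < 1 - Real.exp (-(1 / 2)) := by linarith
    positivity
  refine ⟨κ / 2, by positivity, ?_⟩
  have hsm := (hl.tendsto_exp_div hT0 t₀).mul_const (2 * B)
  rw [zero_mul] at hsm
  filter_upwards [eventually_ge_atTop T, eventually_ge_atTop t₀,
    hsm.eventually_le_const (show 0 < κ / 2 by positivity)] with t htT htt hsmall
  have ht : 0 < t := hT0.trans_le htT
  have hlt := (hT t htT).1
  have hi1 := integrableOn_starKernel_mono htt hi
  have hi2 := integrableOn_starKernel_mono (show t₀ ≤ 2 * t by linarith) hi
  rw [lstar_eq l ht, lstar_eq l (by linarith : 0 < 2 * t), integral_Ioi_starKernel_split hT0 hi1,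
    integral_Ioi_starKernel_split hT0 hi2]
  have hs1 := abs_setIntegral_starKernel_le (S := T) htt hi
  have hs2 := abs_setIntegral_starKernel_le (S := T) (show t₀ ≤ 2 * t by linarith) hi
  have he : Real.exp (-((2 * t - t₀) / T)) ≤ Real.exp (-((t - t₀) / T)) := by
    gcongr; linarith
  have hs2' : b * |∫ s in Ioc 0 T, starKernel l (2 * t) s| ≤ Real.exp (-((t - t₀) / T)) * B :=
    (mul_le_of_le_one_left (abs_nonneg _) hb1).trans (hs2.trans (by gcongr))
  have hs3 : Real.exp (-((t - t₀) / T)) * B * 2 ≤ κ / 2 * l t := by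
    rw [div_mul_eq_mul_div, div_le_iff₀ hlt] at hsmall
    linarith
  have hmain : κ * l t ≤ (∫ s in Ioi T, starKernel l t s)
      - b * ∫ s in Ioi T, starKernel l (2 * t) s := by
    have hi1' := hi1.mono_set (Ioi_subset_Ioi hT0.le)
    have hi2' := (hi2.mono_set (Ioi_subset_Ioi hT0.le)).const_mul b
    rw [← integral_const_mul, ← integral_sub hi1' hi2']
    have hid : ∀ s, starKernel l t s - b * starKernel l (2 * t) s
        = Real.exp (-(t / s)) * (1 - b * Real.exp (-(t / s))) * (l s / s) := by
      intro s
      rw [starKernel_eq_mul l t (2 * t), show 2 * t - t = t by ring]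
      unfold starKernel; ring
    have hfac : ∀ s > 0, 0 ≤ 1 - b * Real.exp (-(t / s)) := by
      intro s hs
      have : Real.exp (-(t / s)) ≤ 1 := Real.exp_le_one_iff.2 (by
        have : 0 ≤ t / s := by positivity
        linarith)
      nlinarith [Real.exp_nonneg (-(t / s))]
    have hnn : ∀ s ∈ Ioi T, 0 ≤ starKernel l t s - b * starKernel l (2 * t) s := by
      intro s hs
      have hs0 : 0 < s := hT0.trans hs
      rw [hid]
      have := (hT s (le_of_lt hs)).1
      have := hfac s hs0
      positivity
    have hlow : ∀ s ∈ Ioc t (2 * t), 4 * κ * (l t / 2) / (2 * t)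
        ≤ starKernel l t s - b * starKernel l (2 * t) s := by
      intro s hs
      have hs0 : 0 < s := ht.trans hs.1
      rw [hid]
      have h1 : Real.exp (-1) ≤ Real.exp (-(t / s)) := by
        gcongr
        exact (div_le_one hs0).2 hs.1.le
      have h2 : 1 - Real.exp (-(1 / 2)) ≤ 1 - b * Real.exp (-(t / s)) := by
        have : Real.exp (-(t / s)) ≤ Real.exp (-(1 / 2)) := by
          apply Real.exp_le_exp.2
          rw [neg_le_neg_iff, div_le_div_iff₀ (by norm_num) hs0]; linarith [hs.2]
        nlinarith [Real.exp_nonneg (-(t / s))]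
      have h3 : l t / 2 ≤ l s := by
        have := (hT t htT).2 (s / t) ⟨(one_le_div ht).2 hs.1.le, (div_le_iff₀ ht).2 hs.2⟩
        rw [div_mul_cancel₀ _ ht.ne', abs_lt] at this
        have h4 : 1 / 2 ≤ l s / l t := by linarith [this.1]
        rw [le_div_iff₀ hlt] at h4
        linarith
      have h5 : (l t / 2) / (2 * t) ≤ l s / s := by
        have : 0 ≤ l s := by linarith
        gcongr
        exact hs.2
      have h6 : 0 ≤ 1 - Real.exp (-(1 / 2)) := by
        have : Real.exp (-(1 / 2)) < 1 := Real.exp_lt_one_iff.2 (by norm_num)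
        linarith
      calc 4 * κ * (l t / 2) / (2 * t)
          = Real.exp (-1) * (1 - Real.exp (-(1 / 2))) * ((l t / 2) / (2 * t)) := by
            rw [hκ]; ring
        _ ≤ _ := by gcongr; exact mul_nonneg (Real.exp_nonneg _) (hfac s hs0)
    calc κ * l t = ∫ s in Ioc t (2 * t), 4 * κ * (l t / 2) / (2 * t) := by
          rw [setIntegral_const, Real.volume_real_Ioc_of_le (by linarith), smul_eq_mul]
          field_simp; ring
      _ ≤ ∫ s in Ioc t (2 * t), (starKernel l t s - b * starKernel l (2 * t) s) := by
          refine setIntegral_mono_on (integrable_const _) ?_ measurableSet_Ioc hlow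
          exact IntegrableOn.mono_set (t := Ioi T) (hi1'.sub hi2')
            fun s hs => lt_of_le_of_lt htT hs.1
      _ ≤ _ := by
          refine setIntegral_mono_set (hi1'.sub hi2') ?_
            (Eventually.of_forall fun s hs => lt_of_le_of_lt htT hs.1)
          filter_upwards [ae_restrict_mem measurableSet_Ioi] with s hs using hnn s hs
  have a1 := neg_abs_le (∫ s in Ioc 0 T, starKernel l t s)
  have a2 : b * (∫ s in Ioc 0 T, starKernel l (2 * t) s)
      ≤ b * |∫ s in Ioc 0 T, starKernel l (2 * t) s| := by
    gcongr; exact le_abs_self _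
  rw [mul_add]
  linarith

theorem exists_mul_le_lstar {l : ℝ → ℝ} (hl : SlowlyVarying l) {t₀ : ℝ}
    (hi : IntegrableOn (starKernel l t₀) (Ioi 0)) :
    ∃ κ > 0, ∀ᶠ t in atTop, κ * l t ≤ lstar l t := by
  simpa using exists_mul_le_lstar_sub hl hi le_rfl zero_le_one

theorem tendsto_exp_div_lstar {l : ℝ → ℝ} (hl : SlowlyVarying l) {t₀ : ℝ}
    (hi : IntegrableOn (starKernel l t₀) (Ioi 0)) {a : ℝ} (ha : 0 < a) (b : ℝ) :
    Tendsto (fun t => Real.exp (-((t - b) / a)) / lstar l t) atTop (𝓝 0) := by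
  obtain ⟨κ, hκ, h⟩ := exists_mul_le_lstar hl hi
  have h1 := (hl.tendsto_exp_div ha b).const_mul κ⁻¹
  rw [mul_zero] at h1
  refine squeeze_zero' ?_ ?_ h1
  · filter_upwards [h, hl.eventually_pos] with t h1 h2
    have : 0 < lstar l t := (by positivity : 0 < κ * l t).trans_le h1
    positivity
  · filter_upwards [h, hl.eventually_pos] with t h1 h2
    calc Real.exp (-((t - b) / a)) / lstar l t ≤ Real.exp (-((t - b) / a)) / (κ * l t) := by gcongr
      _ = _ := by field_simp

/-- An Abelian theorem for the kernel of `ℓ^*`. -/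
theorem tendsto_integral_starKernel_div_lstar {l h : ℝ → ℝ} (hl : SlowlyVarying l) {t₀ lam : ℝ}
    (ht₀ : 0 < t₀) (hil : IntegrableOn (starKernel l t₀) (Ioi 0))
    (hih : IntegrableOn (starKernel h t₀) (Ioi 0))
    (hlim : Tendsto (fun s => h s / l s) atTop (𝓝 lam)) :
    Tendsto (fun t => (∫ s in Ioi 0, starKernel h t s) / lstar l t) atTop (𝓝 lam) := by
  rw [Metric.tendsto_nhds]
  intro ε hε
  obtain ⟨S, hS⟩ := eventually_atTop.1 ((Metric.tendsto_nhds.1 hlim (ε / 2) (by positivity)).and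
    (hl.eventually_pos.and (eventually_gt_atTop 0)))
  have hS0 : 0 < S := (hS S le_rfl).2.2
  -- By linearity it is enough that the transform of `g`, which is `o(l)`, is `o(lstar l)`: the
  -- range `(0, S]` is exponentially small, and beyond `S` one has `|g| ≤ (ε/2) l`.
  set g : ℝ → ℝ := fun s => h s - lam * l s with hg
  have hgk : ∀ t s, starKernel g t s = starKernel h t s - lam * starKernel l t s := by
    intro t s; simp only [starKernel, hg]; ring
  have hig : IntegrableOn (starKernel g t₀) (Ioi 0) := by
    rw [funext fun s => hgk t₀ s]; exact hih.sub (hil.const_mul lam)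
  set B := ∫ s in Ioi 0, ‖starKernel g t₀ s‖
  set B' := ∫ s in Ioi 0, ‖starKernel l t₀ s‖
  obtain ⟨κ, hκ, hlow⟩ := exists_mul_le_lstar hl hil
  have hsm := (tendsto_exp_div_lstar hl hil hS0 t₀).mul_const (B + ε / 2 * B')
  rw [zero_mul] at hsm
  filter_upwards [hlow, hl.eventually_pos, eventually_ge_atTop t₀,
    hsm.eventually_lt_const (half_pos hε)] with t hlo hlt htt hsmall
  have hpos : 0 < lstar l t := (by positivity : 0 < κ * l t).trans_le hlo
  have ht : 0 < t := ht₀.trans_le htt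
  have hit := integrableOn_starKernel_mono htt hil
  have hiht := integrableOn_starKernel_mono htt hih
  have higt := integrableOn_starKernel_mono htt hig
  have e1 : (∫ s in Ioi 0, starKernel h t s) - lam * lstar l t
      = ∫ s in Ioi 0, starKernel g t s := by
    rw [lstar_eq l ht, ← integral_const_mul, ← integral_sub hiht (hit.const_mul lam)]
    simp only [hgk]
  have e2 : |∫ s in Ioi S, starKernel g t s| ≤ ε / 2 * ∫ s in Ioi S, starKernel l t s := by
    rw [← integral_const_mul]
    rw [← Real.norm_eq_abs]
    refine norm_integral_le_of_norm_le ((hit.mono_set (Ioi_subset_Ioi hS0.le)).const_mul _) ?_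
    filter_upwards [ae_restrict_mem measurableSet_Ioi] with s hs
    obtain ⟨q1, q2, q3⟩ := hS s (le_of_lt hs)
    have q4 : |g s| ≤ ε / 2 * l s := by
      rw [Real.dist_eq] at q1
      have : g s = (h s / l s - lam) * l s := by simp only [hg]; field_simp
      rw [this, abs_mul, abs_of_pos q2]
      gcongr
    unfold starKernel
    rw [norm_mul, Real.norm_of_nonneg (by positivity), Real.norm_eq_abs]
    calc Real.exp (-(t / s)) / s * |g s| ≤ Real.exp (-(t / s)) / s * (ε / 2 * l s) := by gcongr
      _ = _ := by ring
  have e3 := abs_setIntegral_starKernel_le (S := S) htt hig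
  have e4 := abs_setIntegral_starKernel_le (S := S) htt hil
  have e5 := integral_Ioi_starKernel_split hS0 hit
  rw [← lstar_eq l ht] at e5
  -- `l` may be negative on `(0, S]`, so the tail integral can exceed `lstar l t`, but only by an
  -- exponentially small amount.
  have e6 : ∫ s in Ioi S, starKernel l t s ≤ lstar l t + Real.exp (-((t - t₀) / S)) * B' := by
    have := neg_abs_le (∫ s in Ioc 0 S, starKernel l t s)
    linarith
  have e7 : |(∫ s in Ioi 0, starKernel h t s) - lam * lstar l t|
      ≤ ε / 2 * lstar l t + Real.exp (-((t - t₀) / S)) * (B + ε / 2 * B') := by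
    rw [e1, integral_Ioi_starKernel_split hS0 higt]
    refine (abs_add_le _ _).trans ?_
    have : ε / 2 * ∫ s in Ioi S, starKernel l t s
        ≤ ε / 2 * (lstar l t + Real.exp (-((t - t₀) / S)) * B') := by gcongr
    linarith
  rw [Real.dist_eq]
  rw [show (∫ s in Ioi 0, starKernel h t s) / lstar l t - lam
    = ((∫ s in Ioi 0, starKernel h t s) - lam * lstar l t) / lstar l t by field_simp,
    abs_div, abs_of_pos hpos, div_lt_iff₀ hpos]
  rw [div_mul_eq_mul_div, div_lt_iff₀ hpos] at hsmall
  linarith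

/-- `lstar l (c t)` is the transform of `s ↦ l (c s)`, whose ratio to `l` tends to `1`; the Abelian
theorem with `lam = 1` applies. Measurability follows from continuity on `[t₀, ∞)`. -/
theorem slowlyVarying_lstar {l : ℝ → ℝ} (hl : SlowlyVarying l) {t₀ : ℝ} (ht₀ : 0 < t₀)
    (hi : IntegrableOn (starKernel l t₀) (Ioi 0)) : SlowlyVarying (lstar l) := by
  refine ⟨?_, fun c hc => ?_⟩
  · obtain ⟨κ, hκ, hlow⟩ := exists_mul_le_lstar hl hi
    obtain ⟨X, hX⟩ := eventually_atTop.1 (hlow.and hl.eventually_pos)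
    refine ⟨max X t₀, lt_max_of_lt_right ht₀, ?_, fun t ht => ?_⟩
    · have hc : ContinuousOn (lstar l) (Ici t₀) := by
        refine ContinuousOn.congr (f := fun t => ∫ s in Ioi 0, starKernel l t s) ?_
          fun t ht => lstar_eq l (ht₀.trans_le ht)
        refine continuousOn_of_dominated (bound := fun s => ‖starKernel l t₀ s‖)
          (fun t ht => (integrableOn_starKernel_mono ht hi).aestronglyMeasurable)
          (fun t ht => ?_) hi.norm ?_
        · filter_upwards [ae_restrict_mem measurableSet_Ioi] with s hs
          exact norm_starKernel_le l hs ht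
        · refine Eventually.of_forall fun s => Continuous.continuousOn ?_
          unfold starKernel
          fun_prop
      exact (hc.mono (Ici_subset_Ici.2 (le_max_right _ _))).aemeasurable measurableSet_Ici
    · obtain ⟨h1, h2⟩ := hX t ((le_max_left _ _).trans ht)
      exact (by positivity : 0 < κ * l t).trans_le h1
  · set h : ℝ → ℝ := fun s => l (c * s)
    have hk : ∀ t s, starKernel h t s = c * starKernel l (c * t) (c * s) := by
      intro t s
      simp only [starKernel, h]
      rw [mul_div_mul_left _ _ hc.ne']
      field_simp
    have hint : ∀ t, t₀ / c ≤ t → IntegrableOn (starKernel h t) (Ioi 0) := by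
      intro t ht
      rw [funext fun s => hk t s]
      refine Integrable.const_mul ?_ c
      have h1 := integrableOn_Ioi_comp_mul_left_iff (starKernel l (c * t)) 0 hc
      rw [mul_zero] at h1
      refine h1.2 (integrableOn_starKernel_mono ?_ hi)
      rwa [div_le_iff₀' hc] at ht
    have := tendsto_integral_starKernel_div_lstar hl (t₀ := max t₀ (t₀ / c))
      (lt_max_of_lt_left ht₀) (integrableOn_starKernel_mono (le_max_left _ _) hi)
      (hint _ (le_max_right _ _)) (hl.2 c hc)
    refine this.congr' ?_
    filter_upwards [eventually_gt_atTop 0] with t ht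
    rw [funext fun s => hk t s, integral_const_mul]
    have h1 := integral_comp_mul_left_Ioi (starKernel l (c * t)) 0 hc
    rw [mul_zero] at h1
    rw [h1, lstar_eq l (by positivity : 0 < c * t), smul_eq_mul, mul_inv_cancel_left₀ hc.ne']

/-- A multiple of `l t` is eventually bounded by the increment `lstar l t - lstar l (2t)`, which
slow variation of `lstar l` makes negligible against `lstar l t`. -/
theorem tendsto_div_lstar {l : ℝ → ℝ} (hl : SlowlyVarying l) {t₀ : ℝ} (ht₀ : 0 < t₀)
    (hi : IntegrableOn (starKernel l t₀) (Ioi 0)) :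
    Tendsto (fun t => l t / lstar l t) atTop (𝓝 0) := by
  obtain ⟨κ, hκ, hd⟩ := exists_mul_le_lstar_sub hl hi zero_le_one le_rfl
  have hs := slowlyVarying_lstar hl ht₀ hi
  have h1 := ((hs.2 2 (by norm_num)).const_sub 1).const_mul κ⁻¹
  rw [sub_self, mul_zero] at h1
  refine squeeze_zero' ?_ ?_ h1
  · filter_upwards [hl.eventually_pos, hs.eventually_pos] with t h1 h2
    positivity
  · filter_upwards [hd, hs.eventually_pos] with t h1 h2
    rw [one_mul] at h1
    rw [inv_mul_eq_div, le_div_iff₀ hκ, div_mul_eq_mul_div, div_le_iff₀ h2, sub_mul,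
      div_mul_cancel₀ _ h2.ne']
    linarith

/-! ### Laplace transforms of counting functions -/

/-- The substitution `x = 1 / s` identifies the Laplace transform of `N` with the transform of `s ↦
N(1/s)/s`. For `α = 1` the ratio of that function to `l` tends to `lam`, so the Abelian theorem
gives the Laplace transform. -/
theorem starKernel_counting (N : ℝ → ℝ) (t : ℝ) {s : ℝ} (hs : 0 < s) :
    starKernel (fun s => N (1 / s) / s) t s
      = (|(-1 : ℝ)| * s ^ ((-1 : ℝ) - 1)) • (N (s ^ (-1 : ℝ)) * Real.exp (-(t * s ^ (-1 : ℝ)))) := by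
  unfold starKernel
  rw [abs_neg, abs_one, one_mul, Real.rpow_neg_one, Real.rpow_sub_one hs.ne', Real.rpow_neg_one,
    smul_eq_mul]
  simp only [one_div]
  field_simp

theorem integral_starKernel_counting (N : ℝ → ℝ) (t : ℝ) :
    ∫ s in Ioi 0, starKernel (fun s => N (1 / s) / s) t s
      = ∫ x in Ioi 0, N x * Real.exp (-(t * x)) := by
  rw [← integral_comp_rpow_Ioi (fun x => N x * Real.exp (-(t * x))) (show (-1 : ℝ) ≠ 0 by norm_num)]
  exact setIntegral_congr_fun measurableSet_Ioi fun s hs => starKernel_counting N t hs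

theorem integrableOn_mul_exp {N : ℝ → ℝ} (hN : IntegrableOn N (Ioi 0)) {t : ℝ} (ht : 0 ≤ t) :
    IntegrableOn (fun x => N x * Real.exp (-(t * x))) (Ioi 0) := by
  refine Integrable.mono hN (hN.aestronglyMeasurable.mul
    (Measurable.aestronglyMeasurable (by fun_prop))) ?_
  filter_upwards [ae_restrict_mem measurableSet_Ioi] with x hx
  rw [norm_mul]
  refine mul_le_of_le_one_right (norm_nonneg _) ?_
  rw [Real.norm_of_nonneg (Real.exp_nonneg _)]
  have : 0 ≤ t * x := mul_nonneg ht (le_of_lt hx)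
  exact Real.exp_le_one_iff.2 (by linarith)

theorem integrableOn_starKernel_counting {N : ℝ → ℝ} (hN : IntegrableOn N (Ioi 0)) {t : ℝ}
    (ht : 0 ≤ t) : IntegrableOn (starKernel (fun s => N (1 / s) / s) t) (Ioi 0) := by
  have := (integrableOn_Ioi_comp_rpow_iff (fun x => N x * Real.exp (-(t * x)))
    (show (-1 : ℝ) ≠ 0 by norm_num)).2 (integrableOn_mul_exp hN ht)
  exact this.congr_fun (fun s hs => (starKernel_counting N t hs).symm) measurableSet_Ioi

theorem tendsto_counting_div {l N : ℝ → ℝ} {lam : ℝ}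
    (hlim : Tendsto (fun x : ℝ => N x / (l (1 / x) * x ^ (-1 : ℝ))) (𝓝[>] 0) (𝓝 lam)) :
    Tendsto (fun s => N (1 / s) / s / l s) atTop (𝓝 lam) := by
  have h := hlim.comp tendsto_inv_atTop_nhdsGT_zero
  refine h.congr fun s => ?_
  simp only [Function.comp]
  rw [Real.rpow_neg_one, inv_inv, one_div, inv_inv, one_div, div_div, mul_comm]

/-- Because `lam > 0`, eventually `l s ≤ (2/lam) N(1/s)/s`, and the transform of the right side
converges since `N` is integrable. This controls the upper end; the bounded range is the hypothesis
`hb`. -/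
theorem integrableOn_starIntegrand_of_counting {l N : ℝ → ℝ} (hl : SlowlyVarying l) {lam t₀ : ℝ}
    (ht₀ : 0 < t₀) (hlam : 0 < lam) (hN : IntegrableOn N (Ioi 0))
    (hlim : Tendsto (fun x : ℝ => N x / (l (1 / x) * x ^ (-1 : ℝ))) (𝓝[>] 0) (𝓝 lam))
    (hb : ∀ b : ℝ, 0 < b → IntegrableOn (starIntegrand l t₀) (Ioc 0 b)) :
    IntegrableOn (starIntegrand l t₀) (Ioi 0) := by
  have hev := (tendsto_counting_div hlim).eventually_const_le (half_lt_self hlam)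
  obtain ⟨S, hS⟩ := eventually_atTop.1 (hev.and (hl.eventually_pos.and (eventually_gt_atTop 0)))
  obtain ⟨X, hX, hm, -⟩ := hl.1
  set Y := max S X
  have hY : 0 < Y := lt_max_of_lt_right hX
  have hbk : IntegrableOn (starKernel l t₀) (Ioc 0 Y) := by
    have h1 := hb (Y / t₀) (by positivity)
    rw [← intervalIntegrable_iff_integrableOn_Ioc_of_le (by positivity)] at h1 ⊢
    have h2 := h1.comp_mul_right (c := t₀⁻¹)
    rw [zero_div, div_inv_eq_mul, div_mul_cancel₀ _ ht₀.ne'] at h2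
    have h3 := h2.const_mul t₀⁻¹
    refine h3.congr fun s _ => ?_
    rw [starIntegrand_eq l ht₀, inv_mul_cancel_left₀ ht₀.ne', mul_comm s, mul_inv_cancel_left₀ ht₀.ne']
  rw [integrableOn_starIntegrand_iff l ht₀, ← Ioc_union_Ioi_eq_Ioi hY.le]
  refine hbk.union ?_
  have hc := ((integrableOn_starKernel_counting hN ht₀.le).mono_set
    (Ioi_subset_Ioi hY.le)).const_mul (2 / lam)
  refine Integrable.mono' hc ?_ ?_
  · have hm' : AEMeasurable l (volume.restrict (Ioi Y)) := hm.mono_measure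
      (Measure.restrict_mono (fun s hs => (le_max_right S X).trans (le_of_lt hs)) le_rfl)
    have : AEMeasurable (fun s => Real.exp (-(t₀ / s)) / s) (volume.restrict (Ioi Y)) :=
      Measurable.aemeasurable (by fun_prop)
    exact (this.mul hm').aestronglyMeasurable
  · filter_upwards [ae_restrict_mem measurableSet_Ioi] with s hs
    obtain ⟨h1, h2, h3⟩ := hS s ((le_max_left S X).trans (le_of_lt hs))
    rw [le_div_iff₀ h2] at h1
    unfold starKernel
    rw [Real.norm_of_nonneg (by positivity)]
    calc Real.exp (-(t₀ / s)) / s * l s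
        = 2 / lam * (Real.exp (-(t₀ / s)) / s * (lam / 2 * l s)) := by field_simp
      _ ≤ _ := by gcongr

/-- For `α = 1`, `s = 0` the scaled integrand tends to `lam * y⁻¹ e^{-y}`, which is not integrable
at `0` unless `lam = 0`, so scaling is replaced by the Laplace transform `H`. It enters at `n - 1`
from above and at `2n` from below; neither change of argument matters, because `lstar l` varies
slowly. -/
theorem tendsto_integral_orderDensity_zero {l N : ℝ → ℝ} (hl : SlowlyVarying l) {lam t₀ : ℝ}
    (ht₀ : 0 < t₀) (hi : IntegrableOn (starIntegrand l t₀) (Ioi 0))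
    (hN : IntegrableOn N (Ioi 0)) (hN0 : ∀ x > 0, 0 ≤ N x) (hN1 : ∀ x > 1, N x = 0)
    (hlim : Tendsto (fun x : ℝ => N x / (l (1 / x) * x ^ (-1 : ℝ))) (𝓝[>] 0) (𝓝 lam)) :
    Tendsto (fun n : ℕ => (∫ x in Ioc (0 : ℝ) 1, N x * orderDensity n 0 x) / (n * lstar l n))
      atTop (𝓝 lam) := by
  rw [integrableOn_starIntegrand_iff l ht₀] at hi
  have hs := slowlyVarying_lstar hl ht₀ hi
  set H : ℝ → ℝ := fun t => ∫ x in Ioi 0, N x * Real.exp (-(t * x))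
  have hH : Tendsto (fun t => H t / lstar l t) atTop (𝓝 lam) := by
    refine (tendsto_integral_starKernel_div_lstar hl ht₀ hi
      (integrableOn_starKernel_counting hN ht₀.le) (tendsto_counting_div hlim)).congr fun t => ?_
    rw [integral_starKernel_counting]
  have hres : ∀ g : ℝ → ℝ, ∫ x in Ioi 0, N x * g x = ∫ x in Ioc 0 1, N x * g x := by
    intro g
    refine (setIntegral_eq_of_subset_of_forall_sdiff_eq_zero measurableSet_Ioi
      Ioc_subset_Ioi_self fun x hx => ?_)
    rw [hN1 x, zero_mul]
    by_contra h
    exact hx.2 ⟨hx.1, not_lt.1 h⟩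
  have hNi : IntegrableOn N (Ioc 0 1) := hN.mono_set Ioc_subset_Ioi_self
  have hni : ∀ n, IntegrableOn (fun x => N x * (1 - x) ^ (n - 1)) (Ioc 0 1) := by
    intro n
    refine Integrable.mono hNi (hNi.aestronglyMeasurable.mul
      (Continuous.aestronglyMeasurable (by fun_prop))) ?_
    filter_upwards [ae_restrict_mem measurableSet_Ioc] with x hx
    rw [norm_mul]
    refine mul_le_of_le_one_right (norm_nonneg _) ?_
    have h0 : 0 ≤ 1 - x := by linarith [hx.2]
    rw [Real.norm_of_nonneg (by positivity)]
    exact pow_le_one₀ h0 (by linarith [hx.1])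
  set I : ℕ → ℝ := fun n => ∫ x in Ioc (0 : ℝ) 1, N x * (1 - x) ^ (n - 1)
  have hI : ∀ᶠ n : ℕ in atTop, I n / lstar l n
      = (∫ x in Ioc (0 : ℝ) 1, N x * orderDensity n 0 x) / (n * lstar l n) := by
    filter_upwards [eventually_ge_atTop 1] with n hn
    have hn' : (n : ℝ) ≠ 0 := by positivity
    have : ∫ x in Ioc (0 : ℝ) 1, N x * orderDensity n 0 x = n * I n := by
      rw [← integral_const_mul]
      refine setIntegral_congr_fun measurableSet_Ioc fun x _ => ?_
      simp only [orderDensity, Nat.choose_zero_right, pow_zero, Nat.cast_one, Nat.sub_zero]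
      ring
    rw [this, mul_div_mul_left _ _ hn']
  refine Tendsto.congr' hI ?_
  have hup : ∀ n : ℕ, 1 ≤ n → I n ≤ H (n - 1 : ℕ) := by
    intro n hn
    simp only [H, I]
    rw [hres]
    refine setIntegral_mono_on (hni n) ((integrableOn_mul_exp hN (by positivity)).mono_set
      Ioc_subset_Ioi_self) measurableSet_Ioc fun x hx => ?_
    have h0 : 0 ≤ 1 - x := by linarith [hx.2]
    refine mul_le_mul_of_nonneg_left ?_ (hN0 x hx.1)
    rw [← mul_neg, Real.exp_nat_mul]
    gcongr
    have := Real.add_one_le_exp (-x); linarith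
  have hlo : ∀ n : ℕ, H (2 * n) - Real.exp (-n) * (∫ x in Ioc 0 1, N x) ≤ I n := by
    intro n
    simp only [H, I]
    rw [hres, ← integral_const_mul, ← integral_sub ((integrableOn_mul_exp hN
      (by positivity)).mono_set Ioc_subset_Ioi_self) (hNi.const_mul _)]
    refine setIntegral_mono_on (((integrableOn_mul_exp hN (by positivity)).mono_set
      Ioc_subset_Ioi_self).sub (hNi.const_mul _)) (hni n) measurableSet_Ioc fun x hx => ?_
    have h0 : 0 ≤ 1 - x := by linarith [hx.2]
    have hNx := hN0 x hx.1
    -- For `x ≤ 1/2` this rests on `e^{-2x} ≤ 1 - x`; for larger `x` the left side is not positive.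
    have : Real.exp (-(2 * n * x)) - Real.exp (-n) ≤ (1 - x) ^ (n - 1) := by
      rcases le_total x (1 / 2) with hx2 | hx2
      · have h3 : Real.exp (-(2 * x)) ≤ 1 - x := by
          rw [Real.exp_neg, inv_le_comm₀ (Real.exp_pos _) (by linarith)]
          have := Real.add_one_le_exp (2 * x)
          refine le_trans ?_ this
          rw [inv_le_iff_one_le_mul₀ (by linarith)]
          nlinarith [hx.1]
        calc Real.exp (-(2 * n * x)) - Real.exp (-n) ≤ Real.exp (-(2 * n * x)) := by
              linarith [Real.exp_pos (-(n : ℝ))]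
          _ = Real.exp (-(2 * x)) ^ n := by rw [← Real.exp_nat_mul]; congr 1; ring
          _ ≤ (1 - x) ^ n := by gcongr
          _ ≤ (1 - x) ^ (n - 1) := pow_le_pow_of_le_one h0 (by linarith [hx.1]) (Nat.sub_le _ _)
      · have : Real.exp (-(2 * n * x)) ≤ Real.exp (-n) := by
          gcongr
          nlinarith [(Nat.cast_nonneg n : (0 : ℝ) ≤ n)]
        have : 0 ≤ (1 - x) ^ (n - 1) := by positivity
        linarith
    calc N x * Real.exp (-(2 * n * x)) - Real.exp (-n) * N x
        = N x * (Real.exp (-(2 * n * x)) - Real.exp (-n)) := by ring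
      _ ≤ _ := by gcongr
  have hnat := tendsto_natCast_atTop_atTop (R := ℝ)
  have hsub : Tendsto (fun n : ℕ => ((n - 1 : ℕ) : ℝ)) atTop atTop :=
    hnat.comp (tendsto_sub_atTop_nat 1)
  have hratio : Tendsto (fun n : ℕ => lstar l n / lstar l ((n - 1 : ℕ) : ℝ)) atTop (𝓝 1) := by
    refine hs.tendsto_ratio hsub (Eventually.of_forall fun n => by
      exact_mod_cast Nat.sub_le n 1) ?_
    rw [← tendsto_add_atTop_iff_nat 1]
    have := (tendsto_natCast_div_add_atTop (1 : ℝ)).inv₀ one_ne_zero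
    rw [inv_one] at this
    refine this.congr fun n => ?_
    simp
  have hupper : Tendsto (fun n : ℕ => H ((n - 1 : ℕ) : ℝ) / lstar l n) atTop (𝓝 lam) := by
    have := (hH.comp hsub).div hratio one_ne_zero
    rw [div_one] at this
    refine this.congr' ?_
    filter_upwards [hsub.eventually hs.eventually_pos, hnat.eventually hs.eventually_pos]
      with n h1 h2
    simp only [Function.comp, Pi.div_apply]
    field_simp
  have h2n : Tendsto (fun n : ℕ => 2 * (n : ℝ)) atTop atTop :=
    hnat.const_mul_atTop (by norm_num)
  have hlower : Tendsto (fun n : ℕ => (H (2 * n) - Real.exp (-n) * (∫ x in Ioc 0 1, N x))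
      / lstar l n) atTop (𝓝 lam) := by
    have h1 := (hH.comp h2n).mul ((hs.2 2 (by norm_num)).comp hnat)
    have h2 := ((tendsto_exp_div_lstar hl hi one_pos 0).comp hnat).mul_const
      (∫ x in Ioc 0 1, N x)
    have h3 := h1.sub h2
    rw [mul_one, zero_mul, sub_zero] at h3
    refine h3.congr' ?_
    filter_upwards [h2n.eventually hs.eventually_pos, hnat.eventually hs.eventually_pos]
      with n h1 h2
    simp only [Function.comp, sub_zero, div_one]
    field_simp
  refine tendsto_of_tendsto_of_tendsto_of_le_of_le' hlower hupper ?_ ?_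
  · filter_upwards [hnat.eventually hs.eventually_pos] with n h2
    exact div_le_div_of_nonneg_right (hlo n) h2.le
  · filter_upwards [hnat.eventually hs.eventually_pos, eventually_ge_atTop 1] with n h2 h1
    exact div_le_div_of_nonneg_right (hup n h1) h2.le

/-! ### Gaps of a closed set -/

section Gaps

variable {F : Set ℝ}

theorem gaps_subset {C : Set ℝ} (hC : C ∈ gaps F) : C ⊆ Icc (0 : ℝ) 1 \ F := by
  obtain ⟨p, hp, rfl⟩ := hC
  exact connectedComponentIn_subset _ _

theorem gaps_ordConnected {C : Set ℝ} (hC : C ∈ gaps F) : C.OrdConnected := by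
  obtain ⟨p, hp, rfl⟩ := hC
  exact isPreconnected_connectedComponentIn.ordConnected

theorem gaps_measurableSet {C : Set ℝ} (hC : C ∈ gaps F) : MeasurableSet C :=
  (gaps_ordConnected hC).measurableSet

theorem gaps_eq_of_mem {C : Set ℝ} (hC : C ∈ gaps F) {x : ℝ} (hx : x ∈ C) :
    C = connectedComponentIn (Icc (0 : ℝ) 1 \ F) x := by
  obtain ⟨p, hp, rfl⟩ := hC
  exact connectedComponentIn_eq hx

theorem gaps_pairwiseDisjoint : (gaps F).PairwiseDisjoint id := by
  intro C hC D hD hne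
  rw [Function.onFun, Set.disjoint_left]
  intro x hxC hxD
  exact hne ((gaps_eq_of_mem hC hxC).trans (gaps_eq_of_mem hD hxD).symm)

/-- A gap that contains `0` or `1` is not open, so countability is drawn from nonempty interiors
instead. -/
theorem gaps_nonempty_interior (hF : IsClosed F) {C : Set ℝ} (hC : C ∈ gaps F) :
    (interior C).Nonempty := by
  obtain ⟨p, ⟨⟨hp0, hp1⟩, hpF⟩, rfl⟩ := hC
  obtain ⟨ε, hε, hball⟩ := Metric.isOpen_iff.1 hF.isOpen_compl p hpF
  have hlt : max (p - ε) 0 < min (p + ε) 1 := by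
    rw [max_lt_iff, lt_min_iff, lt_min_iff]
    refine ⟨⟨by linarith, by linarith⟩, by linarith, by norm_num⟩
  have hsub : Ioo (max (p - ε) 0) (min (p + ε) 1)
      ⊆ connectedComponentIn (Icc (0 : ℝ) 1 \ F) p := by
    have hpre : Ioo (p - ε) (p + ε) ∩ Icc 0 1 ⊆ connectedComponentIn (Icc (0 : ℝ) 1 \ F) p := by
      refine IsPreconnected.subset_connectedComponentIn ?_ ⟨⟨by linarith, by linarith⟩, hp0, hp1⟩ ?_
      · exact (ordConnected_Ioo.inter ordConnected_Icc).isPreconnected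
      · rintro x ⟨hx, hx'⟩
        refine ⟨hx', hball ?_⟩
        rwa [Real.ball_eq_Ioo]
    refine Subset.trans ?_ hpre
    rintro x ⟨h1, h2⟩
    rw [max_lt_iff] at h1
    rw [lt_min_iff] at h2
    exact ⟨⟨h1.1, h2.1⟩, h1.2.le, h2.2.le⟩
  obtain ⟨q, hq⟩ := nonempty_Ioo.2 hlt
  exact ⟨q, interior_maximal hsub isOpen_Ioo hq⟩

theorem gaps_countable (hF : IsClosed F) : (gaps F).Countable :=
  gaps_pairwiseDisjoint.countable_of_nonempty_interior fun _ hC => gaps_nonempty_interior hF hC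

theorem gaps_volume_ne_top {C : Set ℝ} (hC : C ∈ gaps F) : volume C ≠ ⊤ :=
  ((measure_mono ((gaps_subset hC).trans sdiff_subset)).trans_lt
    (measure_Icc_lt_top (a := (0 : ℝ)) (b := 1))).ne

theorem tsum_volume_gaps_le (hF : IsClosed F) : ∑' C : gaps F, volume (C : Set ℝ) ≤ 1 := by
  have : Countable (gaps F) := (gaps_countable hF).to_subtype
  rw [← measure_iUnion (f := fun C : gaps F => (C : Set ℝ))
    (fun C D hne => gaps_pairwiseDisjoint C.2 D.2 (Subtype.coe_injective.ne hne))
    (fun C => gaps_measurableSet C.2)]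
  refine (measure_mono (iUnion_subset fun C => (gaps_subset C.2).trans sdiff_subset)).trans ?_
  simp

theorem exists_gap_of_mem {x : ℝ} (hx : x ∈ Icc (0 : ℝ) 1 \ F) : ∃ C : gaps F, x ∈ (C : Set ℝ) :=
  ⟨⟨_, x, hx, rfl⟩, mem_connectedComponentIn hx⟩

/-- The bridge from blocks to gaps: an interval that misses `F` is a connected subset of `[0,1] \ F`
and stays in one component; conversely components are order convex. -/
theorem inter_uIcc_eq_empty_iff {x y : ℝ} (hy : y ∈ Icc (0 : ℝ) 1 \ F)
    {C : Set ℝ} (hC : C ∈ gaps F) (hxC : x ∈ C) : F ∩ uIcc x y = ∅ ↔ y ∈ C := by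
  rw [← disjoint_iff_inter_eq_empty]
  constructor
  · intro h
    rw [gaps_eq_of_mem hC hxC]
    refine isPreconnected_uIcc.subset_connectedComponentIn left_mem_uIcc ?_ right_mem_uIcc
    intro z hz
    have hx := gaps_subset hC hxC
    exact ⟨ordConnected_Icc.uIcc_subset hx.1 hy.1 hz, fun hzF => Set.disjoint_left.1 h hzF hz⟩
  · intro h
    rw [Set.disjoint_left]
    intro z hzF hz
    exact (gaps_subset hC ((gaps_ordConnected hC).uIcc_subset hxC h hz)).2 hzF

end Gaps

/-! ### Counting functions of summable families -/

/-- The number of terms of the family `p` that are at least `x`. -/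
noncomputable def countingFun {ι : Type*} (p : ι → ℝ) (x : ℝ) : ℕ := {i | x ≤ p i}.ncard

theorem ncard_eq_tsum_indicator {ι : Type*} {S : Set ι} (hS : S.Finite) :
    (S.ncard : ENNReal) = ∑' i, S.indicator (fun _ => (1 : ENNReal)) i := by
  rw [← tsum_subtype, ENNReal.tsum_set_one, ← hS.cast_ncard_eq]
  simp

section Counting

variable {ι : Type*} {p : ι → ℝ}

/-- `ncard` is `0` on infinite sets; finiteness makes `countingFun` the true count. -/
theorem finite_le_of_tsum_le (hp : ∑' i, ENNReal.ofReal (p i) ≤ 1) {x : ℝ} (hx : 0 < x) :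
    {i | x ≤ p i}.Finite := by
  refine (ENNReal.finite_const_le_of_tsum_ne_top (hp.trans_lt ENNReal.one_lt_top).ne
    (ε := ENNReal.ofReal x) (by simpa using hx)).subset ?_
  intro i hi
  exact ENNReal.ofReal_le_ofReal hi

theorem countingFun_eq_tsum (hp : ∑' i, ENNReal.ofReal (p i) ≤ 1) {x : ℝ} (hx : 0 < x) :
    (countingFun p x : ENNReal)
      = ∑' i, (Ioc 0 (p i)).indicator (fun _ => (1 : ENNReal)) x := by
  rw [countingFun, ncard_eq_tsum_indicator (finite_le_of_tsum_le hp hx)]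
  refine tsum_congr fun i => ?_
  simp [indicator_apply, hx]

theorem countingFun_antitoneOn (hp : ∑' i, ENNReal.ofReal (p i) ≤ 1) :
    AntitoneOn (fun x => (countingFun p x : ℝ)) (Ioi 0) := by
  intro x hx y _ hxy
  have : countingFun p y ≤ countingFun p x :=
    ncard_le_ncard (fun i (hi : y ≤ p i) => hxy.trans hi) (finite_le_of_tsum_le hp hx)
  exact Nat.cast_le.2 this

theorem countingFun_eq_zero (hp : ∑' i, ENNReal.ofReal (p i) ≤ 1) {x : ℝ} (hx : 1 < x) :
    countingFun p x = 0 := by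
  rw [countingFun, ncard_eq_zero (finite_le_of_tsum_le hp (by linarith)), eq_empty_iff_forall_notMem]
  intro i hi
  have h1 := (ENNReal.le_tsum i).trans hp
  rw [ENNReal.ofReal_le_one] at h1
  have h2 : x ≤ p i := hi
  linarith

/-- Tonelli: the counting function is the sum of the indicators of `(0, p i]`. With `g = 1` it
yields integrability, with `g` an order statistic density the mean occupancy. -/
theorem lintegral_countingFun_mul [Countable ι] (hp : ∑' i, ENNReal.ofReal (p i) ≤ 1)
    {g : ℝ → ENNReal} (hg : Measurable g) :
    ∫⁻ x in Ioi 0, (countingFun p x : ENNReal) * g x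
      = ∑' i, ∫⁻ x in Ioc 0 (p i), g x := by
  have h1 : ∫⁻ x in Ioi 0, (countingFun p x : ENNReal) * g x
      = ∫⁻ x in Ioi 0, ∑' i, (Ioc 0 (p i)).indicator g x := by
    refine setLIntegral_congr_fun measurableSet_Ioi fun x hx => ?_
    rw [countingFun_eq_tsum hp hx, ← ENNReal.tsum_mul_right]
    refine tsum_congr fun i => ?_
    simp only [indicator_apply]
    split_ifs <;> simp
  rw [h1, lintegral_tsum fun i => (hg.indicator measurableSet_Ioc).aemeasurable]
  refine tsum_congr fun i => ?_
  rw [lintegral_indicator measurableSet_Ioc, Measure.restrict_restrict measurableSet_Ioc,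
    inter_eq_left.2 Ioc_subset_Ioi_self]

theorem integrableOn_countingFun [Countable ι] (hp : ∑' i, ENNReal.ofReal (p i) ≤ 1) :
    IntegrableOn (fun x => (countingFun p x : ℝ)) (Ioi 0) := by
  refine ⟨(aemeasurable_restrict_of_antitoneOn measurableSet_Ioi
    (countingFun_antitoneOn hp)).aestronglyMeasurable, ?_⟩
  rw [hasFiniteIntegral_iff_ofReal (Eventually.of_forall fun x => Nat.cast_nonneg _)]
  have := lintegral_countingFun_mul hp (g := fun _ => 1) measurable_const
  simp only [mul_one, lintegral_const, one_mul, Measure.restrict_apply_univ, Real.volume_Ioc,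
    sub_zero] at this
  simp only [ENNReal.ofReal_natCast]
  rw [this]
  exact hp.trans_lt ENNReal.one_lt_top

end Counting

/-- The lengths of the gaps of `F`. -/
noncomputable def gapLength (F : Set ℝ) (C : gaps F) : ℝ := volume.real (C : Set ℝ)

theorem tsum_ofReal_gap_le {F : Set ℝ} (hF : IsClosed F) :
    ∑' C : gaps F, ENNReal.ofReal (gapLength F C) ≤ 1 := by
  refine le_trans (le_of_eq (tsum_congr fun C => ?_)) (tsum_volume_gaps_le hF)
  exact ofReal_measureReal (gaps_volume_ne_top C.2)

theorem gapCount_eq_countingFun (F : Set ℝ) (x : ℝ) :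
    gapCount F x = countingFun (gapLength F) x := by
  rw [gapCount, countingFun, ← ncard_image_of_injective _ Subtype.coe_injective]
  congr 1
  ext C
  simp [and_comm, gapLength]

/-! ### Occupancy of fixed sets: binomial law and negative correlation -/

open scoped Classical in
/-- The number of the first `n` points of `v` that lie in `A`. -/
noncomputable def hits (A : Set ℝ) (v : ℕ → ℝ) (n : ℕ) : ℕ :=
  ((Finset.range n).filter (fun k => v k ∈ A)).card

theorem hits_mono (A : Set ℝ) (v : ℕ → ℝ) : Monotone (hits A v) := by
  classical
  exact fun _ _ h => Finset.card_le_card (Finset.filter_subset_filter _ (Finset.range_mono h))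

section BinomialTail

/-- The distribution function of the position of the `(s + 1)`-st smallest of `n` uniform points
is the tail of a binomial distribution. -/
theorem integral_orderDensity (n s : ℕ) (p : ℝ) :
    ∫ x in (0 : ℝ)..p, orderDensity n s x
      = 1 - ∑ k ∈ Finset.range (s + 1), (bernsteinPolynomial ℝ n k).eval p := by
  -- The derivatives of the binomial probabilities telescope in `k`, leaving only the top term.
  have hder : ∀ s : ℕ, ∀ x : ℝ,
      HasDerivAt (fun x => 1 - ∑ k ∈ Finset.range (s + 1), (bernsteinPolynomial ℝ n k).eval x)
        (orderDensity n s x) x := by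
    intro s x
    have h1 : HasDerivAt
        (fun x => 1 - ∑ k ∈ Finset.range (s + 1), (bernsteinPolynomial ℝ n k).eval x)
        (-∑ k ∈ Finset.range (s + 1), (Polynomial.derivative (bernsteinPolynomial ℝ n k)).eval x)
        x := by
      refine (HasDerivAt.fun_sum fun k _ => Polynomial.hasDerivAt _ x).const_sub 1
    convert h1 using 1
    have hB : orderDensity n s x = (n * bernsteinPolynomial ℝ (n - 1) s).eval x := by
      simp [orderDensity, bernsteinPolynomial]
    rw [hB]
    clear h1 hB
    induction s with
    | zero => simp [bernsteinPolynomial.derivative_zero]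
    | succ s ih =>
      rw [Finset.sum_range_succ, neg_add, ← ih, bernsteinPolynomial.derivative_succ]
      simp only [Polynomial.eval_mul, Polynomial.eval_sub]
      ring
  rw [intervalIntegral.integral_eq_sub_of_hasDerivAt (fun x _ => hder s x)
    ((continuous_orderDensity n s).intervalIntegrable _ _)]
  have h0 : ∑ k ∈ Finset.range (s + 1), (bernsteinPolynomial ℝ n k).eval (0 : ℝ) = 1 := by
    rw [Finset.sum_eq_single 0]
    · simp [bernsteinPolynomial.eval_at_0]
    · intro k _ hk
      simp [bernsteinPolynomial.eval_at_0, hk]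
    · simp
  rw [h0]
  ring

end BinomialTail

section Independent

variable {Ω : Type*} [MeasurableSpace Ω] {P : Measure Ω} [IsProbabilityMeasure P] {u : ℕ → Ω → ℝ}

theorem measurable_hits (humeas : ∀ i, Measurable (u i)) {A : Set ℝ} (hA : MeasurableSet A)
    (n : ℕ) : Measurable fun ω => hits A (fun i => u i ω) n := by
  classical
  have : (fun ω => hits A (fun i => u i ω) n)
      = fun ω => ∑ k ∈ Finset.range n, if u k ω ∈ A then 1 else 0 := by
    ext ω
    rw [hits, Finset.card_filter]
  rw [this]
  exact Finset.measurable_fun_sum _ fun k _ =>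
    Measurable.ite (humeas k hA) measurable_const measurable_const

/-- The binomial law, obtained by splitting according to the set `S` of indices whose points hit
`A`. -/
theorem measure_hits_eq (hind : iIndepFun u P) (humeas : ∀ i, Measurable (u i)) {A : Set ℝ}
    (hA : MeasurableSet A) {p : ℝ} (hp : ∀ i, P.real (u i ⁻¹' A) = p) (n k : ℕ) :
    P.real {ω | hits A (fun i => u i ω) n = k} = (bernsteinPolynomial ℝ n k).eval p := by
  classical
  set E : Finset ℕ → Set Ω := fun S =>
    ⋂ i ∈ Finset.range n, u i ⁻¹' (if i ∈ S then A else Aᶜ) with hE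
  have hmem : ∀ S ω, ω ∈ E S ↔ ∀ i < n, (u i ω ∈ A ↔ i ∈ S) := by
    intro S ω
    simp only [hE, mem_iInter, Finset.mem_range, mem_preimage]
    refine forall₂_congr fun i _ => ?_
    split_ifs with h <;> simp [h]
  have hEmeas : ∀ S, MeasurableSet (E S) := fun S =>
    Finset.measurableSet_biInter _ fun i _ => humeas i (by split_ifs; exacts [hA, hA.compl])
  have hunion : {ω | hits A (fun i => u i ω) n = k}
      = ⋃ S ∈ (Finset.range n).powersetCard k, E S := by
    ext ω
    simp only [mem_ofPred_eq, mem_iUnion, exists_prop, Finset.mem_powersetCard]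
    constructor
    · intro h
      refine ⟨_, ⟨Finset.filter_subset _ _, h⟩, (hmem _ _).2 fun i hi => ?_⟩
      simp [hi]
    · rintro ⟨S, ⟨hS, rfl⟩, hω⟩
      rw [hits]
      congr 1
      ext i
      rw [Finset.mem_filter, Finset.mem_range]
      constructor
      · rintro ⟨h1, h2⟩
        exact ((hmem _ _).1 hω i h1).1 h2
      · intro h
        have hi := Finset.mem_range.1 (hS h)
        exact ⟨hi, ((hmem _ _).1 hω i hi).2 h⟩
  have hdisj : ((Finset.range n).powersetCard k : Set (Finset ℕ)).PairwiseDisjoint E := by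
    intro S hS T hT hne
    rw [Function.onFun, Set.disjoint_left]
    intro ω h1 h2
    apply hne
    rw [Finset.mem_coe, Finset.mem_powersetCard] at hS hT
    ext i
    constructor
    · intro hi
      have hin := Finset.mem_range.1 (hS.1 hi)
      exact ((hmem _ _).1 h2 i hin).1 (((hmem _ _).1 h1 i hin).2 hi)
    · intro hi
      have hin := Finset.mem_range.1 (hT.1 hi)
      exact ((hmem _ _).1 h1 i hin).1 (((hmem _ _).1 h2 i hin).2 hi)
  rw [hunion, measureReal_biUnion_finset hdisj fun S _ => hEmeas S]
  have hprob : ∀ S ∈ (Finset.range n).powersetCard k, P.real (E S) = p ^ k * (1 - p) ^ (n - k) := by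
    intro S hS
    rw [Finset.mem_powersetCard] at hS
    rw [measureReal_def, hE, hind.measure_inter_preimage_eq_mul (Finset.range n)
      (sets := fun i => if i ∈ S then A else Aᶜ)
      (fun i _ => by split_ifs; exacts [hA, hA.compl]), ENNReal.toReal_prod]
    have h1 : ∀ i ∈ Finset.range n, (P (u i ⁻¹' (if i ∈ S then A else Aᶜ))).toReal
        = if i ∈ S then p else 1 - p := by
      intro i _
      split_ifs
      · exact hp i
      · rw [preimage_compl, ← measureReal_def, probReal_compl_eq_one_sub (humeas i hA), hp i]
    rw [Finset.prod_congr rfl h1, Finset.prod_ite, Finset.prod_const, Finset.prod_const,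
      Finset.filter_mem_eq_inter, Finset.inter_eq_right.2 hS.1, hS.2, ← Finset.sdiff_eq_filter,
      Finset.card_sdiff_of_subset hS.1, hS.2, Finset.card_range]
  rw [Finset.sum_congr rfl hprob, Finset.sum_const, Finset.card_powersetCard, Finset.card_range]
  simp [bernsteinPolynomial]
  ring

theorem measure_lt_hits (hind : iIndepFun u P) (humeas : ∀ i, Measurable (u i)) {A : Set ℝ}
    (hA : MeasurableSet A) {p : ℝ} (hp : ∀ i, P.real (u i ⁻¹' A) = p) (n s : ℕ) :
    P.real {ω | s < hits A (fun i => u i ω) n} = ∫ x in (0 : ℝ)..p, orderDensity n s x := by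
  have hm : ∀ k, MeasurableSet {ω | hits A (fun i => u i ω) n = k} := fun k =>
    measurable_hits humeas hA n (measurableSet_singleton k)
  rw [integral_orderDensity]
  have : {ω | s < hits A (fun i => u i ω) n}
      = (⋃ k ∈ Finset.range (s + 1), {ω | hits A (fun i => u i ω) n = k})ᶜ := by
    ext ω
    simp only [mem_ofPred_eq, mem_compl_iff, mem_iUnion, Finset.mem_range, exists_prop,
      exists_eq_right']
    omega
  rw [this, probReal_compl_eq_one_sub (Finset.measurableSet_biUnion _ fun k _ => hm k), measureReal_biUnion_finset]
  · congr 1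
    exact Finset.sum_congr rfl fun k _ => measure_hits_eq hind humeas hA hp n k
  · intro a _ b _ hab
    rw [Function.onFun, Set.disjoint_left]
    intro ω h1 h2
    exact hab (h1.symm.trans h2)
  · exact fun k _ => hm k

/-- The law of the colours of the first `n` sample points. -/
theorem measure_color_eq (hind : iIndepFun u P) (humeas : ∀ i, Measurable (u i)) {K : Type*}
    [Fintype K] [MeasurableSpace K] [MeasurableSingletonClass K] {c : ℝ → K} (hc : Measurable c)
    {w : K → ℝ} (hw : ∀ i j, P.real (u i ⁻¹' (c ⁻¹' {j})) = w j) (n : ℕ)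
    (Q : Set (Fin n → K)) :
    P.real {ω | (fun i : Fin n => c (u i ω)) ∈ Q} = ∑ a, (∏ i, w (a i)) * Q.indicator 1 a := by
  classical
  have hind' : iIndepFun (fun i : Fin n => u i) P := hind.precomp Fin.val_injective
  set E : (Fin n → K) → Set Ω := fun a => {ω | (fun i : Fin n => c (u i ω)) = a}
  have hE : ∀ a, E a = ⋂ i ∈ (Finset.univ : Finset (Fin n)), u i ⁻¹' (c ⁻¹' {a i}) := by
    intro a
    ext ω
    simp [E, funext_iff]
  have hEm : ∀ a, MeasurableSet (E a) := fun a => by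
    rw [hE]
    exact Finset.measurableSet_biInter _ fun i _ => humeas i (hc (measurableSet_singleton _))
  have hprob : ∀ a, P.real (E a) = ∏ i, w (a i) := by
    intro a
    rw [measureReal_def, hE, hind'.measure_inter_preimage_eq_mul Finset.univ
      (sets := fun i => c ⁻¹' {a i}) (fun i _ => hc (measurableSet_singleton _)),
      ENNReal.toReal_prod]
    exact Finset.prod_congr rfl fun i _ => hw i (a i)
  have hunion : {ω | (fun i : Fin n => c (u i ω)) ∈ Q}
      = ⋃ a ∈ (Finset.univ.filter fun a => a ∈ Q), E a := by
    ext ω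
    simp [E]
  rw [hunion, measureReal_biUnion_finset, Finset.sum_filter]
  · refine Finset.sum_congr rfl fun a _ => ?_
    rw [hprob]
    by_cases h : a ∈ Q <;> simp [h]
  · intro a _ b _ hab
    rw [Function.onFun, Set.disjoint_left]
    intro ω h1 h2
    exact hab (h1.symm.trans h2)
  · exact fun a _ => hEm a

theorem hits_eq_card_fin (A : Set ℝ) (v : ℕ → ℝ) (n : ℕ) {Q : Fin n → Prop} [DecidablePred Q]
    (hQ : ∀ i : Fin n, v i ∈ A ↔ Q i) :
    hits A v n = (Finset.univ.filter Q).card := by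
  classical
  rw [hits]
  symm
  refine Finset.card_bij (fun i _ => (i : ℕ)) ?_ ?_ ?_
  · intro i hi
    simpa [hQ] using hi
  · intro i _ j _ h
    exact Fin.ext h
  · intro k hk
    rw [Finset.mem_filter, Finset.mem_range] at hk
    exact ⟨⟨k, hk.1⟩, by simpa using (hQ ⟨k, hk.1⟩).1 hk.2, rfl⟩

/-- The occupancy numbers of disjoint sets are negatively correlated. -/
theorem measure_lt_hits_inter_le (hind : iIndepFun u P) (humeas : ∀ i, Measurable (u i))
    (hid : ∀ i, P.map (u i) = P.map (u 0)) {A B : Set ℝ} (hA : MeasurableSet A)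
    (hB : MeasurableSet B) (hAB : Disjoint A B) (n s : ℕ) :
    P.real ({ω | s < hits A (fun i => u i ω) n} ∩ {ω | s < hits B (fun i => u i ω) n})
      ≤ P.real {ω | s < hits A (fun i => u i ω) n}
        * P.real {ω | s < hits B (fun i => u i ω) n} := by
  classical
  -- `A` gets the lowest colour and `B` the highest. Raising colours can only remove points from `A`
  -- and add points to `B`, so the two events are respectively decreasing and increasing in the
  -- product order.
  set c : ℝ → Fin 3 := fun x => if x ∈ A then 0 else if x ∈ B then 2 else 1 with hcdef
  have hc : Measurable c :=
    Measurable.ite hA measurable_const (Measurable.ite hB measurable_const measurable_const)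
  have hcA : ∀ x, x ∈ A ↔ c x = 0 := by
    intro x
    simp only [hcdef]
    split_ifs <;> simp_all
  have hcB : ∀ x, x ∈ B ↔ c x = 2 := by
    intro x
    have := fun h : x ∈ A => Set.disjoint_left.1 hAB h
    simp only [hcdef]
    by_cases hb : x ∈ B
    · have ha : x ∉ A := fun ha => this ha hb
      simp [ha, hb]
    · by_cases ha : x ∈ A <;> simp [ha, hb]
  set w : Fin 3 → ℝ := fun j => (P.map (u 0)).real (c ⁻¹' {j})
  have hw : ∀ i j, P.real (u i ⁻¹' (c ⁻¹' {j})) = w j := by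
    intro i j
    simp only [w]
    rw [← hid i, map_measureReal_apply (humeas i) (hc (measurableSet_singleton j))]
  have hw0 : ∀ j, 0 ≤ w j := fun j => measureReal_nonneg
  set QA : Set (Fin n → Fin 3) := {a | s < (Finset.univ.filter fun i => a i = 0).card} with hQA
  set QB : Set (Fin n → Fin 3) := {a | s < (Finset.univ.filter fun i => a i = 2).card} with hQB
  have eA : {ω | s < hits A (fun i => u i ω) n} = {ω | (fun i : Fin n => c (u i ω)) ∈ QA} := by
    ext ω
    simp only [mem_ofPred_eq, hQA]
    rw [hits_eq_card_fin A (fun i => u i ω) n (Q := fun i => c (u i ω) = 0) fun i => hcA _]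
  have eB : {ω | s < hits B (fun i => u i ω) n} = {ω | (fun i : Fin n => c (u i ω)) ∈ QB} := by
    ext ω
    simp only [mem_ofPred_eq, hQB]
    rw [hits_eq_card_fin B (fun i => u i ω) n (Q := fun i => c (u i ω) = 2) fun i => hcB _]
  have eAB : {ω | s < hits A (fun i => u i ω) n} ∩ {ω | s < hits B (fun i => u i ω) n}
      = {ω | (fun i : Fin n => c (u i ω)) ∈ QA ∩ QB} := by
    rw [eA, eB]; rfl
  have law := measure_color_eq hind humeas hc hw n
  set μ : (Fin n → Fin 3) → ℝ := fun a => ∏ i, w (a i) with hμ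
  have htot : ∑ a, μ a = 1 := by
    have := law univ
    simp only [mem_univ, ofPred_true, probReal_univ, indicator_univ, Pi.one_apply, mul_one] at this
    exact this.symm
  -- FKG is applied to the complement of the `A`-event, which is increasing, and to the `B`-event.
  -- The lattice condition holds with equality, since the weights are products over a chain in each
  -- coordinate.
  have hfkg := fkg (fun a => 1 - QA.indicator (1 : (Fin n → Fin 3) → ℝ) a)
    (QB.indicator (1 : (Fin n → Fin 3) → ℝ)) μ
    (fun a => Finset.prod_nonneg fun i _ => hw0 _)
    (fun a => by
      simp only [Pi.zero_apply, indicator_apply, Pi.one_apply]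
      split_ifs <;> norm_num)
    (fun a => by
      simp only [Pi.zero_apply, indicator_apply, Pi.one_apply]
      split_ifs <;> norm_num)
    (fun a b hab => by
      have : b ∈ QA → a ∈ QA := fun hb => lt_of_lt_of_le hb (Finset.card_le_card fun i hi => by
        simp only [Finset.mem_filter, Finset.mem_univ, true_and] at hi ⊢
        have := hab i
        rw [hi] at this
        exact le_antisymm this (Fin.zero_le _))
      by_cases hb : b ∈ QA
      · simp [hb, this hb]
      · by_cases ha : a ∈ QA <;> simp [ha, hb])
    (fun a b hab => by
      have : a ∈ QB → b ∈ QB := fun hb => lt_of_lt_of_le hb (Finset.card_le_card fun i hi => by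
        simp only [Finset.mem_filter, Finset.mem_univ, true_and] at hi ⊢
        have := hab i
        rw [hi] at this
        exact le_antisymm (Fin.le_last _) this)
      by_cases ha : a ∈ QB
      · simp [ha, this ha]
      · by_cases hb : b ∈ QB <;> simp [ha, hb])
    (fun a b => by
      simp only [hμ]
      rw [← Finset.prod_mul_distrib, ← Finset.prod_mul_distrib]
      refine le_of_eq (Finset.prod_congr rfl fun i _ => ?_)
      rw [Pi.inf_apply, Pi.sup_apply]
      rcases le_total (a i) (b i) with h | h
      · rw [inf_eq_left.2 h, sup_eq_right.2 h]
      · rw [inf_eq_right.2 h, sup_eq_left.2 h, mul_comm])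
  rw [eAB, law, eA, law, eB, law]
  have hind2 : ∀ a, (QA ∩ QB).indicator (1 : (Fin n → Fin 3) → ℝ) a
      = QA.indicator 1 a * QB.indicator 1 a := fun a => by
    rw [inter_indicator_one]; rfl
  simp only [hind2]
  rw [htot, one_mul] at hfkg
  simp only [mul_sub, sub_mul, mul_one, one_mul, Finset.sum_sub_distrib] at hfkg
  rw [htot] at hfkg
  simp only [μ] at hfkg
  linarith

end Independent

/-! ### Number of occupied boxes: mean and variance -/

/-- The number of members of the family `𝒜` that contain more than `s` of the first `n` points
of `v`. -/
noncomputable def occupied {ι : Type*} (𝒜 : ι → Set ℝ) (v : ℕ → ℝ) (n s : ℕ) : ℕ :=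
  {i | s < hits (𝒜 i) v n}.ncard

/-- The mean number of boxes that contain more than `s` of `n` balls, when the box frequencies are
given by `p`. -/
noncomputable def meanOccupied {ι : Type*} (p : ι → ℝ) (n s : ℕ) : ℝ :=
  ∫ x in Ioc (0 : ℝ) 1, (countingFun p x : ℝ) * orderDensity n s x

section Occupied

variable {ι : Type*} {𝒜 : ι → Set ℝ}

/-- Each occupied set is charged to one of its sample points; disjointness makes the charge
injective. Finiteness and the bound `n` follow. -/
theorem exists_injOn_of_hits (hd : Pairwise (Function.onFun Disjoint 𝒜)) (v : ℕ → ℝ) (n s : ℕ) :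
    ∃ f : ι → ℕ, MapsTo f {i | s < hits (𝒜 i) v n} (Finset.range n) ∧
      InjOn f {i | s < hits (𝒜 i) v n} := by
  classical
  have h : ∀ i, ∃ k, s < hits (𝒜 i) v n → k ∈ Finset.range n ∧ v k ∈ 𝒜 i := by
    intro i
    by_cases hi : s < hits (𝒜 i) v n
    · obtain ⟨k, hk⟩ := Finset.card_pos.1 ((Nat.zero_le s).trans_lt hi)
      exact ⟨k, fun _ => Finset.mem_filter.1 hk⟩
    · exact ⟨0, fun h => absurd h hi⟩
  choose f hf using h
  refine ⟨f, fun i hi => (hf i hi).1, fun i hi j hj hij => ?_⟩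
  by_contra hne
  have h2 := (hf j hj).2
  rw [← hij] at h2
  exact Set.disjoint_left.1 (hd hne) (hf i hi).2 h2

theorem finite_lt_hits (hd : Pairwise (Function.onFun Disjoint 𝒜)) (v : ℕ → ℝ) (n s : ℕ) :
    {i | s < hits (𝒜 i) v n}.Finite := by
  obtain ⟨f, hf, hinj⟩ := exists_injOn_of_hits hd v n s
  exact Set.Finite.of_injOn hf hinj (Finset.finite_toSet _)

theorem occupied_le (hd : Pairwise (Function.onFun Disjoint 𝒜)) (v : ℕ → ℝ) (n s : ℕ) :
    occupied 𝒜 v n s ≤ n := by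
  obtain ⟨f, hf, hinj⟩ := exists_injOn_of_hits hd v n s
  have := ncard_le_ncard_of_injOn f hf hinj (Finset.finite_toSet _)
  rwa [ncard_coe_finset, Finset.card_range] at this

theorem occupied_mono (hd : Pairwise (Function.onFun Disjoint 𝒜)) (v : ℕ → ℝ) (s : ℕ) :
    Monotone fun n => occupied 𝒜 v n s := fun _ m h =>
  ncard_le_ncard (fun i hi => lt_of_lt_of_le hi (hits_mono (𝒜 i) v h)) (finite_lt_hits hd v m s)

theorem occupied_eq_tsum (hd : Pairwise (Function.onFun Disjoint 𝒜)) (v : ℕ → ℝ) (n s : ℕ) :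
    (occupied 𝒜 v n s : ENNReal)
      = ∑' i, {i | s < hits (𝒜 i) v n}.indicator (fun _ => (1 : ENNReal)) i :=
  ncard_eq_tsum_indicator (finite_lt_hits hd v n s)

theorem meanOccupied_nonneg (p : ι → ℝ) (n s : ℕ) : 0 ≤ meanOccupied p n s :=
  setIntegral_nonneg measurableSet_Ioc fun _ hx =>
    mul_nonneg (Nat.cast_nonneg _) (orderDensity_nonneg n s hx.1.le hx.2)

variable [Countable ι] {p : ι → ℝ}

theorem integrableOn_countingFun_mul (hp : ∑' i, ENNReal.ofReal (p i) ≤ 1) (n s : ℕ) :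
    IntegrableOn (fun x => (countingFun p x : ℝ) * orderDensity n s x) (Ioc 0 1) := by
  obtain ⟨c, hc⟩ := (isCompact_Icc (a := (0 : ℝ)) (b := 1)).exists_bound_of_continuousOn
    (continuous_orderDensity n s).continuousOn
  refine Integrable.mul_bdd (c := c)
    ((integrableOn_countingFun hp).mono_set Ioc_subset_Ioi_self)
    (continuous_orderDensity n s).aestronglyMeasurable ?_
  filter_upwards [ae_restrict_mem measurableSet_Ioc] with x hx using hc x ⟨hx.1.le, hx.2⟩

/-- Tonelli again. No box has frequency above `1`, so the integral may stop at `1`; this matters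
because the density can be negative beyond. -/
theorem tsum_ofReal_integral_orderDensity (hp : ∑' i, ENNReal.ofReal (p i) ≤ 1)
    (hp0 : ∀ i, 0 ≤ p i) (n s : ℕ) :
    ∑' i, ENNReal.ofReal (∫ x in (0 : ℝ)..p i, orderDensity n s x)
      = ENNReal.ofReal (meanOccupied p n s) := by
  have hp1 : ∀ i, p i ≤ 1 := fun i => ENNReal.ofReal_le_one.1 ((ENNReal.le_tsum i).trans hp)
  have h1 : ∀ i, ENNReal.ofReal (∫ x in (0 : ℝ)..p i, orderDensity n s x)
      = ∫⁻ x in Ioc 0 (p i), ENNReal.ofReal (orderDensity n s x) := by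
    intro i
    rw [intervalIntegral.integral_of_le (hp0 i), ofReal_integral_eq_lintegral_ofReal]
    · exact (continuous_orderDensity n s).integrableOn_Ioc
    · filter_upwards [ae_restrict_mem measurableSet_Ioc] with x hx
      exact orderDensity_nonneg n s hx.1.le (hx.2.trans (hp1 i))
  rw [tsum_congr h1, ← lintegral_countingFun_mul hp
    (continuous_orderDensity n s).measurable.ennreal_ofReal, meanOccupied,
    ofReal_integral_eq_lintegral_ofReal (integrableOn_countingFun_mul hp n s)]
  · rw [← Ioc_union_Ioi_eq_Ioi (zero_le_one (α := ℝ)),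
      lintegral_union measurableSet_Ioi (Ioc_disjoint_Ioi le_rfl)]
    have h2 : ∫⁻ x in Ioi 1, (countingFun p x : ENNReal) * ENNReal.ofReal (orderDensity n s x)
        = 0 := by
      rw [setLIntegral_congr_fun measurableSet_Ioi (g := fun _ => 0), lintegral_zero]
      intro x hx
      simp [countingFun_eq_zero hp hx]
    rw [h2, add_zero]
    refine lintegral_congr fun x => ?_
    rw [ENNReal.ofReal_mul (Nat.cast_nonneg _), ENNReal.ofReal_natCast]
  · filter_upwards [ae_restrict_mem measurableSet_Ioc] with x hx
    exact mul_nonneg (Nat.cast_nonneg _) (orderDensity_nonneg n s hx.1.le hx.2)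

variable {Ω : Type*} [MeasurableSpace Ω] {P : Measure Ω} [IsProbabilityMeasure P] {u : ℕ → Ω → ℝ}

theorem measurable_occupied (humeas : ∀ i, Measurable (u i))
    (hd : Pairwise (Function.onFun Disjoint 𝒜)) (hm : ∀ i, MeasurableSet (𝒜 i)) (n s : ℕ) :
    Measurable fun ω => (occupied 𝒜 (fun i => u i ω) n s : ENNReal) := by
  simp only [occupied_eq_tsum hd]
  refine Measurable.tsum fun i => ?_
  exact measurable_const.indicator (measurableSet_lt measurable_const
    (measurable_hits humeas (hm i) n))

theorem lintegral_occupied (hind : iIndepFun u P) (humeas : ∀ i, Measurable (u i))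
    (hd : Pairwise (Function.onFun Disjoint 𝒜)) (hm : ∀ i, MeasurableSet (𝒜 i))
    (hprob : ∀ k i, P.real (u k ⁻¹' 𝒜 i) = p i) (hp : ∑' i, ENNReal.ofReal (p i) ≤ 1) (n s : ℕ) :
    ∫⁻ ω, occupied 𝒜 (fun i => u i ω) n s ∂P = ENNReal.ofReal (meanOccupied p n s) := by
  have hE : ∀ i, MeasurableSet {ω | s < hits (𝒜 i) (fun i => u i ω) n} := fun i =>
    measurableSet_lt measurable_const (measurable_hits humeas (hm i) n)
  simp only [occupied_eq_tsum hd]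
  have hsw : ∀ i, (fun ω => {i | s < hits (𝒜 i) (fun i => u i ω) n}.indicator
      (fun _ => (1 : ENNReal)) i)
      = {ω | s < hits (𝒜 i) (fun i => u i ω) n}.indicator 1 := fun i => rfl
  rw [lintegral_tsum fun i => by rw [hsw]; exact (measurable_one.indicator (hE i)).aemeasurable]
  rw [← tsum_ofReal_integral_orderDensity hp (fun i => by rw [← hprob 0 i]; exact measureReal_nonneg)]
  refine tsum_congr fun i => ?_
  rw [hsw, lintegral_indicator_one (hE i), ← measure_lt_hits hind humeas (hm i)
    (fun k => hprob k i), ofReal_measureReal]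

/-- The square is expanded over pairs of boxes. Diagonal pairs give the mean, the others are bounded
by negative correlation, and the missing diagonal products only help. -/
theorem lintegral_occupied_sq_le (hind : iIndepFun u P) (humeas : ∀ i, Measurable (u i))
    (hid : ∀ i, P.map (u i) = P.map (u 0))
    (hd : Pairwise (Function.onFun Disjoint 𝒜)) (hm : ∀ i, MeasurableSet (𝒜 i)) (n s : ℕ) :
    ∫⁻ ω, (occupied 𝒜 (fun i => u i ω) n s : ENNReal) ^ 2 ∂P
      ≤ (∫⁻ ω, occupied 𝒜 (fun i => u i ω) n s ∂P)
        + (∫⁻ ω, occupied 𝒜 (fun i => u i ω) n s ∂P) ^ 2 := by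
  classical
  set E : ι → Set Ω := fun i => {ω | s < hits (𝒜 i) (fun i => u i ω) n} with hEdef
  have hE : ∀ i, MeasurableSet (E i) := fun i =>
    measurableSet_lt measurable_const (measurable_hits humeas (hm i) n)
  have hocc : ∀ ω, (occupied 𝒜 (fun i => u i ω) n s : ENNReal)
      = ∑' i, (E i).indicator 1 ω := fun ω => occupied_eq_tsum hd _ _ _
  have hsq : ∀ ω, (occupied 𝒜 (fun i => u i ω) n s : ENNReal) ^ 2
      = ∑' i, ∑' j, (E i ∩ E j).indicator 1 ω := by
    intro ω
    rw [hocc, sq, ← ENNReal.tsum_mul_right]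
    refine tsum_congr fun i => ?_
    rw [← ENNReal.tsum_mul_left]
    refine tsum_congr fun j => ?_
    rw [inter_indicator_one]; rfl
  have hmean : ∫⁻ ω, occupied 𝒜 (fun i => u i ω) n s ∂P = ∑' i, P (E i) := by
    simp only [hocc]
    rw [lintegral_tsum fun i => (measurable_one.indicator (hE i)).aemeasurable]
    exact tsum_congr fun i => lintegral_indicator_one (hE i)
  have hmean2 : ∫⁻ ω, (occupied 𝒜 (fun i => u i ω) n s : ENNReal) ^ 2 ∂P
      = ∑' i, ∑' j, P (E i ∩ E j) := by
    simp only [hsq]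
    rw [lintegral_tsum fun i => (Measurable.tsum fun j =>
      measurable_one.indicator ((hE i).inter (hE j))).aemeasurable]
    refine tsum_congr fun i => ?_
    rw [lintegral_tsum fun j => (measurable_one.indicator ((hE i).inter (hE j))).aemeasurable]
    exact tsum_congr fun j => lintegral_indicator_one ((hE i).inter (hE j))
  have hpair : ∀ i j, P (E i ∩ E j) ≤ (if j = i then P (E i) else 0) + P (E i) * P (E j) := by
    intro i j
    split_ifs with h
    · subst h
      rw [inter_self]
      exact le_self_add
    · rw [zero_add]
      have := measure_lt_hits_inter_le hind humeas hid (hm i) (hm j) (hd (Ne.symm h)) n s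
      have h2 := ENNReal.ofReal_le_ofReal this
      rwa [ENNReal.ofReal_mul measureReal_nonneg, ofReal_measureReal, ofReal_measureReal,
        ofReal_measureReal] at h2
  rw [hmean2, hmean]
  calc ∑' i, ∑' j, P (E i ∩ E j)
      ≤ ∑' i, ∑' j, ((if j = i then P (E i) else 0) + P (E i) * P (E j)) :=
        ENNReal.tsum_le_tsum fun i => ENNReal.tsum_le_tsum fun j => hpair i j
    _ = _ := by
        simp only [ENNReal.tsum_add, tsum_ite_eq, ENNReal.tsum_mul_left, ENNReal.tsum_mul_right, sq]

/-- The variance of the number of occupied boxes is at most its mean. -/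
theorem lintegral_sq_sub_meanOccupied_le (hind : iIndepFun u P) (humeas : ∀ i, Measurable (u i))
    (hid : ∀ i, P.map (u i) = P.map (u 0))
    (hd : Pairwise (Function.onFun Disjoint 𝒜)) (hm : ∀ i, MeasurableSet (𝒜 i))
    (hprob : ∀ k i, P.real (u k ⁻¹' 𝒜 i) = p i) (hp : ∑' i, ENNReal.ofReal (p i) ≤ 1) (n s : ℕ) :
    ∫⁻ ω, ENNReal.ofReal (((occupied 𝒜 (fun i => u i ω) n s : ℝ) - meanOccupied p n s) ^ 2) ∂P
      ≤ ENNReal.ofReal (meanOccupied p n s) := by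
  set M := meanOccupied p n s with hM
  have hM0 : 0 ≤ M := meanOccupied_nonneg p n s
  have hL := lintegral_occupied hind humeas hd hm hprob hp n s
  have hS := lintegral_occupied_sq_le hind humeas hid hd hm n s
  rw [hL] at hS
  set Z : Ω → ℝ := fun ω => (occupied 𝒜 (fun i => u i ω) n s : ℝ) with hZ
  have hZm : Measurable Z := by
    have := (measurable_occupied humeas hd hm n s).ennreal_toReal
    simpa using this
  have hbd : ∀ ω, ‖Z ω‖ ≤ n := fun ω => by
    rw [Real.norm_of_nonneg (Nat.cast_nonneg _)]
    exact_mod_cast occupied_le hd _ n s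
  have hZi : Integrable Z P := Integrable.of_bound hZm.aestronglyMeasurable n
    (Eventually.of_forall hbd)
  have hZ2i : Integrable (fun ω => Z ω ^ 2) P := by
    refine Integrable.of_bound (hZm.pow_const 2).aestronglyMeasurable ((n : ℝ) ^ 2)
      (Eventually.of_forall fun ω => ?_)
    rw [norm_pow]
    exact pow_le_pow_left₀ (norm_nonneg _) (hbd ω) 2
  have h1 : ∫ ω, Z ω ∂P = M := by
    rw [integral_eq_lintegral_of_nonneg_ae (Eventually.of_forall fun ω => Nat.cast_nonneg _)
      hZm.aestronglyMeasurable]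
    simp only [ENNReal.ofReal_natCast]
    rw [hL, ENNReal.toReal_ofReal hM0]
  have h2 : ∫ ω, Z ω ^ 2 ∂P ≤ M + M ^ 2 := by
    rw [integral_eq_lintegral_of_nonneg_ae (Eventually.of_forall fun ω => sq_nonneg _)
      (hZm.pow_const 2).aestronglyMeasurable]
    refine ENNReal.toReal_le_of_le_ofReal (by positivity) ?_
    rw [ENNReal.ofReal_add hM0 (by positivity), ENNReal.ofReal_pow hM0]
    refine le_trans (le_of_eq (lintegral_congr fun ω => ?_)) hS
    simp only [hZ]
    rw [ENNReal.ofReal_pow (Nat.cast_nonneg _), ENNReal.ofReal_natCast]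
  have h3i : Integrable (fun ω => (Z ω - M) ^ 2) P := by
    have := (hZ2i.sub (hZi.const_mul (2 * M))).add (integrable_const (M ^ 2))
    refine this.congr (Eventually.of_forall fun ω => ?_)
    simp only [Pi.add_apply, Pi.sub_apply]
    ring
  rw [← ofReal_integral_eq_lintegral_ofReal h3i (Eventually.of_forall fun ω => sq_nonneg _)]
  refine ENNReal.ofReal_le_ofReal ?_
  have h4 : ∫ ω, (Z ω - M) ^ 2 ∂P = ∫ ω, (Z ω ^ 2 - 2 * M * Z ω + M ^ 2) ∂P :=
    integral_congr_ae (Eventually.of_forall fun ω => by ring)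
  have h5 : ∫ ω, (Z ω ^ 2 - 2 * M * Z ω + M ^ 2) ∂P = (∫ ω, Z ω ^ 2 ∂P) - 2 * M * M + M ^ 2 := by
    rw [integral_add (f := fun ω => Z ω ^ 2 - 2 * M * Z ω) (hZ2i.sub (hZi.const_mul (2 * M)))
      (integrable_const _), integral_sub hZ2i (hZi.const_mul (2 * M)), integral_const_mul, h1]
    simp
  rw [h4, h5]
  linarith [sq M]

end Occupied

/-! ### Strong law along powers and interpolation -/

theorem exists_pow_le_lt {m : ℕ} (hm : m ≠ 0) (n : ℕ) : ∃ k : ℕ, k ^ m ≤ n ∧ n < (k + 1) ^ m := by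
  have hex : ∃ k : ℕ, n < (k + 1) ^ m :=
    ⟨n, (Nat.lt_succ_self n).trans_le (Nat.le_self_pow hm _)⟩
  classical
  refine ⟨Nat.find hex, ?_, Nat.find_spec hex⟩
  rcases h : Nat.find hex with _ | j
  · simp [hm]
  · exact not_lt.1 (Nat.find_min hex (m := j) (by omega))

/-- A monotone sequence that behaves regularly along the `m`-th powers behaves regularly. -/
theorem tendsto_div_of_tendsto_div_pow {f : ℝ → ℝ} (hf : SlowlyVarying f) {α c : ℝ} {m : ℕ}
    (hm : m ≠ 0) {z : ℕ → ℝ} (hz : Monotone z)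
    (h : Tendsto (fun k : ℕ => z (k ^ m) / (((k ^ m : ℕ) : ℝ) ^ α * f ((k ^ m : ℕ) : ℝ))) atTop
      (𝓝 c)) :
    Tendsto (fun n : ℕ => z n / ((n : ℝ) ^ α * f n)) atTop (𝓝 c) := by
  -- Sandwich `z (k^m) ≤ z n ≤ z ((k+1)^m)`; consecutive `m`-th powers have ratio tending to `1`, so
  -- the three normalisations are equivalent.
  choose k hk1 hk2 using exists_pow_le_lt hm
  have hk : Tendsto k atTop atTop := by
    refine tendsto_atTop.2 fun b => ?_
    filter_upwards [eventually_ge_atTop (b ^ m)] with n hn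
    by_contra! hlt
    exact absurd (hk2 n) (not_lt.2 ((Nat.pow_le_pow_left hlt m).trans hn))
  have hk' : Tendsto (fun n => k n + 1) atTop atTop := (tendsto_add_atTop_nat 1).comp hk
  have hpow : Tendsto (fun k : ℕ => ((k ^ m : ℕ) : ℝ)) atTop atTop :=
    tendsto_natCast_atTop_atTop.comp (tendsto_pow_atTop hm)
  have hnat := tendsto_natCast_atTop_atTop (R := ℝ)
  have hq : Tendsto (fun n : ℕ => ((k n : ℝ) / (k n + 1)) ^ m) atTop (𝓝 1) := by
    simpa using ((tendsto_natCast_div_add_atTop (1 : ℝ)).comp hk).pow m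
  have hpos : ∀ᶠ n : ℕ in atTop, 0 < n := eventually_gt_atTop 0
  have hr1 : Tendsto (fun n : ℕ => ((k n ^ m : ℕ) : ℝ) / n) atTop (𝓝 1) := by
    refine tendsto_of_tendsto_of_tendsto_of_le_of_le' hq tendsto_const_nhds ?_ ?_
    · filter_upwards [hpos] with n hn
      rw [div_pow]
      push_cast
      have : (n : ℝ) ≤ (k n + 1) ^ m := by exact_mod_cast (hk2 n).le
      gcongr
    · filter_upwards [hpos] with n hn
      have hn' : (0 : ℝ) < n := by exact_mod_cast hn
      rw [div_le_one hn']
      exact_mod_cast hk1 n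
  have hr2 : Tendsto (fun n : ℕ => (((k n + 1) ^ m : ℕ) : ℝ) / n) atTop (𝓝 1) := by
    have hqi := hq.inv₀ one_ne_zero
    rw [inv_one] at hqi
    refine tendsto_of_tendsto_of_tendsto_of_le_of_le' tendsto_const_nhds hqi ?_ ?_
    · filter_upwards [hpos] with n hn
      have hn' : (0 : ℝ) < n := by exact_mod_cast hn
      rw [one_le_div hn']
      exact_mod_cast (hk2 n).le
    · filter_upwards [hpos, hk.eventually_gt_atTop 0] with n hn hkn
      rw [div_pow, inv_div]
      push_cast
      have h1 : (k n : ℝ) ^ m ≤ n := by exact_mod_cast hk1 n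
      have h2 : (0 : ℝ) < k n := by exact_mod_cast hkn
      gcongr
  have hs1 := hf.tendsto_ratio (hpow.comp hk) (Eventually.of_forall fun n => by
      simp only [Function.comp]; exact_mod_cast hk1 n)
    (s := fun n : ℕ => (n : ℝ)) (by
      have := hr1.inv₀ one_ne_zero
      simpa using this)
  have hs2 := hf.tendsto_ratio hnat (Eventually.of_forall fun n => by exact_mod_cast (hk2 n).le) hr2
  -- `tendsto_ratio` requires the larger argument in the numerator, so the correction by `f` divides
  -- in the lower bound and multiplies in the upper one.
  have ha1 := (h.comp hk).mul ((hr1.rpow_const (p := α) (Or.inl one_ne_zero)).div hs1 one_ne_zero)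
  have ha2 := (h.comp hk').mul ((hr2.rpow_const (p := α) (Or.inl one_ne_zero)).mul hs2)
  simp only [Real.one_rpow, div_one, mul_one] at ha1 ha2
  have p0 := hnat.eventually hf.eventually_pos
  have p1 := (hpow.comp hk).eventually hf.eventually_pos
  have p2 := (hpow.comp hk').eventually hf.eventually_pos
  refine tendsto_of_tendsto_of_tendsto_of_le_of_le' ha1 ha2 ?_ ?_
  · filter_upwards [p0, p1, hpos, hk.eventually_gt_atTop 0] with n h0 h1 hn hkn
    have hn' : (0 : ℝ) < n := by exact_mod_cast hn
    have hkm : (0 : ℝ) < ((k n ^ m : ℕ) : ℝ) := by positivity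
    simp only [Function.comp, Pi.div_apply] at h1 ⊢
    rw [Real.div_rpow hkm.le hn'.le]
    calc _ = z (k n ^ m) / ((n : ℝ) ^ α * f n) := by
            have := Real.rpow_pos_of_pos hkm α
            field_simp
      _ ≤ _ := by
        gcongr
        exact hz (hk1 n)
  · filter_upwards [p0, p2, hpos] with n h0 h1 hn
    have hn' : (0 : ℝ) < n := by exact_mod_cast hn
    have hkm : (0 : ℝ) < (((k n + 1) ^ m : ℕ) : ℝ) := by positivity
    simp only [Function.comp] at h1 ⊢
    rw [Real.div_rpow hkm.le hn'.le]
    calc _ ≤ z ((k n + 1) ^ m) / ((n : ℝ) ^ α * f n) := by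
          gcongr
          exact hz (hk2 n).le
      _ = _ := by
        have := Real.rpow_pos_of_pos hkm α
        field_simp

/-- A strong law for monotone sequences whose variances are bounded by regularly varying means. -/
theorem ae_tendsto_of_variance_le {Ω : Type*} [MeasurableSpace Ω] {P : Measure Ω}
    {Z : ℕ → Ω → ℝ} (hZm : ∀ n, Measurable (Z n))
    (hmono : ∀ ω, Monotone fun n => Z n ω) {M : ℕ → ℝ}
    (hvar : ∀ n, ∫⁻ ω, ENNReal.ofReal ((Z n ω - M n) ^ 2) ∂P ≤ ENNReal.ofReal (M n))
    {f : ℝ → ℝ} (hf : SlowlyVarying f) {α c : ℝ} (hα : 0 < α)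
    (hM : Tendsto (fun n : ℕ => M n / ((n : ℝ) ^ α * f n)) atTop (𝓝 c)) :
    ∀ᵐ ω ∂P, Tendsto (fun n : ℕ => Z n ω / ((n : ℝ) ^ α * f n)) atTop (𝓝 c) := by
  -- The normalisation at `n` is at least `κ n^{α/2}`, so `m ≥ 4/α` makes it at least `κ k²` at `n =
  -- k^m`. The normalised variances are then `O(1/k²)`.
  obtain ⟨κ, hκ, T, hT0, hT⟩ := hf.exists_rpow_le (half_lt_self hα)
  obtain ⟨m, hmα⟩ := exists_nat_ge (4 / α)
  have hm0 : m ≠ 0 := by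
    rintro rfl
    have : 0 < 4 / α := by positivity
    simp only [Nat.cast_zero] at hmα
    linarith
  rw [div_le_iff₀ hα] at hmα
  set a : ℕ → ℝ := fun n => (n : ℝ) ^ α * f n with ha
  have hpowN : Tendsto (fun k : ℕ => k ^ m) atTop atTop := tendsto_pow_atTop hm0
  have hev : ∀ᶠ k : ℕ in atTop, 0 < a (k ^ m) ∧ κ * (k : ℝ) ^ 2 ≤ a (k ^ m)
      ∧ M (k ^ m) / a (k ^ m) ≤ c + 1 := by
    filter_upwards [(tendsto_natCast_atTop_atTop.comp hpowN).eventually_ge_atTop T,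
      hpowN.eventually (hM.eventually_le_const (lt_add_one c)), eventually_ge_atTop 1]
      with k h1 h2 h3
    obtain ⟨q1, q2⟩ := hT _ h1
    simp only [Function.comp] at q1 q2 h1
    refine ⟨mul_pos (Real.rpow_pos_of_pos (hT0.trans_le h1) _) q1, le_trans ?_ q2, h2⟩
    have h3' : (1 : ℝ) ≤ k := by exact_mod_cast h3
    gcongr
    push_cast
    rw [← Real.rpow_natCast, ← Real.rpow_natCast, ← Real.rpow_mul (by linarith)]
    refine Real.rpow_le_rpow_of_exponent_le h3' ?_
    push_cast
    linarith
  obtain ⟨k₀, hk₀⟩ := eventually_atTop.1 hev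
  set D : ℕ → Ω → ℝ := fun k ω => (Z (k ^ m) ω - M (k ^ m)) / a (k ^ m) with hD
  have hDint : ∀ k ≥ k₀, ∫⁻ ω, ENNReal.ofReal (D k ω ^ 2) ∂P
      ≤ ENNReal.ofReal ((|c| + 1) / κ * (1 / (k : ℝ) ^ 2)) := by
    intro k hk
    obtain ⟨h1, h2, h3⟩ := hk₀ k hk
    have e1 : ∀ ω, ENNReal.ofReal (D k ω ^ 2)
        = ENNReal.ofReal (1 / a (k ^ m) ^ 2)
          * ENNReal.ofReal ((Z (k ^ m) ω - M (k ^ m)) ^ 2) := by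
      intro ω
      rw [← ENNReal.ofReal_mul (by positivity)]
      congr 1
      simp only [hD, div_pow]
      ring
    simp only [e1]
    rw [lintegral_const_mul' _ _ ENNReal.ofReal_ne_top]
    refine (mul_le_mul_right (hvar _) _).trans ?_
    rw [← ENNReal.ofReal_mul (by positivity)]
    refine ENNReal.ofReal_le_ofReal ?_
    -- The index `0` is excluded: there the normalisation vanishes because `0 ^ α = 0`.
    rcases Nat.eq_zero_or_pos k with rfl | hk0
    · exfalso
      simp only [zero_pow hm0, ha, Nat.cast_zero, Real.zero_rpow hα.ne', zero_mul, lt_irrefl] at h1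
    · have hk0' : (0 : ℝ) < k := by exact_mod_cast hk0
      calc 1 / a (k ^ m) ^ 2 * M (k ^ m) = (M (k ^ m) / a (k ^ m)) * (1 / a (k ^ m)) := by
            field_simp
        _ ≤ (|c| + 1) * (1 / a (k ^ m)) := by
            gcongr
            linarith [le_abs_self c]
        _ ≤ (|c| + 1) * (1 / (κ * (k : ℝ) ^ 2)) := by gcongr
        _ = _ := by field_simp
  have hsum : ∑' k : ℕ, ∫⁻ ω, ENNReal.ofReal (D (k + k₀) ω ^ 2) ∂P ≠ ⊤ := by
    have hs : Summable fun k : ℕ => (|c| + 1) / κ * (1 / ((k + k₀ : ℕ) : ℝ) ^ 2) :=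
      ((summable_nat_add_iff (f := fun k : ℕ => 1 / (k : ℝ) ^ 2) k₀).2
        (Real.summable_one_div_nat_pow.2 (by norm_num))).mul_left _
    refine ne_top_of_le_ne_top hs.tsum_ofReal_ne_top (ENNReal.tsum_le_tsum fun k => ?_)
    exact hDint (k + k₀) (Nat.le_add_left _ _)
  -- The series of squared deviations has finite expectation, hence converges almost surely and its
  -- terms tend to `0`.
  rw [← lintegral_tsum fun k => (Measurable.ennreal_ofReal
    ((((hZm _).sub_const _).div_const _).pow_const 2)).aemeasurable] at hsum
  have hae := ae_lt_top' (AEMeasurable.tsum fun k => (Measurable.ennreal_ofReal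
    ((((hZm _).sub_const _).div_const _).pow_const 2)).aemeasurable) hsum
  filter_upwards [hae] with ω hω
  refine tendsto_div_of_tendsto_div_pow hf hm0 (hmono ω) ?_
  have h1 := ENNReal.tendsto_atTop_zero_of_tsum_ne_top hω.ne
  have h2 : Tendsto (fun k => D (k + k₀) ω ^ 2) atTop (𝓝 0) := by
    have := (ENNReal.tendsto_toReal ENNReal.zero_ne_top).comp h1
    simp only [ENNReal.toReal_zero] at this
    refine this.congr fun k => ?_
    exact ENNReal.toReal_ofReal (sq_nonneg _)
  have h3 : Tendsto (fun k => D k ω) atTop (𝓝 0) := by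
    rw [← tendsto_add_atTop_iff_nat k₀]
    have := h2.sqrt
    simp only [Real.sqrt_sq_eq_abs, Real.sqrt_zero] at this
    exact (tendsto_zero_iff_abs_tendsto_zero _).2 this
  have h4 := h3.add (hM.comp hpowN)
  rw [zero_add] at h4
  refine h4.congr fun k => ?_
  simp only [hD, Function.comp]
  rw [← add_div, sub_add_cancel]

/-! ### From fixed sets to an independent random set -/

/-- An almost sure limit theorem that holds for every fixed value of a parameter holds for a
random parameter that is independent of the sample. -/
theorem ae_tendsto_of_indepFun {Ω α β : Type*} [MeasurableSpace Ω] [MeasurableSpace α]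
    [MeasurableSpace β] {P : Measure Ω} [IsProbabilityMeasure P] {R : Ω → α} {U : Ω → β}
    (hR : Measurable R) (hU : Measurable U) (hRU : IndepFun R U P) {X : ℕ → α × β → ℝ}
    (hX : ∀ n, Measurable (X n)) {v : Ω → ℝ}
    (h : ∀ᵐ ω ∂P, ∀ᵐ ω' ∂P, Tendsto (fun n => X n (R ω, U ω')) atTop (𝓝 (v ω))) :
    ∀ᵐ ω ∂P, Tendsto (fun n => X n (R ω, U ω)) atTop (𝓝 (v ω)) := by
  set ν := P.map U
  have : IsProbabilityMeasure ν := Measure.isProbabilityMeasure_map hU.aemeasurable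
  -- The arctangent bounds the variables, so that for almost every value of `R` the averages `V n`
  -- over the sample converge to `arctan v` by dominated convergence. The tangent undoes it at the
  -- end.
  set Y : ℕ → α × β → ℝ := fun n x => Real.arctan (X n x)
  have hY : ∀ n, Measurable (Y n) := fun n => Real.measurable_arctan.comp (hX n)
  set V : ℕ → α → ℝ := fun n a => ∫ b, Y n (a, b) ∂ν
  have hV : ∀ n, Measurable (V n) := fun n =>
    (hY n).stronglyMeasurable.integral_prod_right'.measurable
  -- The limit `v` is a function on `Ω`, not assumed measurable nor a function of `R`. Comparison
  -- with `V n` instead of `v` gives a measurable set in the product space, to which Fubini applies.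
  set A : Set (α × β) := {x | Tendsto (fun n => Y n x - V n x.1) atTop (𝓝 0)}
  have hA : MeasurableSet A := measurableSet_tendsto _ fun n =>
    (hY n).sub ((hV n).comp measurable_fst)
  have hVlim : ∀ᵐ ω ∂P, Tendsto (fun n => V n (R ω)) atTop (𝓝 (Real.arctan (v ω))) := by
    filter_upwards [h] with ω hω
    have hVeq : ∀ n, V n (R ω) = ∫ ω', Y n (R ω, U ω') ∂P := fun n =>
      integral_map hU.aemeasurable
        ((hY n).comp measurable_prodMk_left).aestronglyMeasurable
    simp only [hVeq]
    have hlim := tendsto_integral_of_dominated_convergence (μ := P)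
      (F := fun n ω' => Y n (R ω, U ω')) (f := fun _ => Real.arctan (v ω))
      (fun _ => Real.pi / 2)
      (fun n => ((hY n).comp (measurable_prodMk_left.comp hU)).aestronglyMeasurable)
      (integrable_const _)
      (fun n => Eventually.of_forall fun ω' =>
        abs_le.2 ⟨(Real.neg_pi_div_two_lt_arctan _).le, (Real.arctan_lt_pi_div_two _).le⟩)
      (by
        filter_upwards [hω] with ω' hω'
        exact (Real.continuous_arctan.tendsto _).comp hω')
    simpa using hlim
  have hfib : ∀ᵐ ω ∂P, ν (Prod.mk (R ω) ⁻¹' Aᶜ) = 0 := by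
    filter_upwards [h, hVlim] with ω hω hVω
    rw [Measure.map_apply hU (measurable_prodMk_left hA.compl)]
    have : ∀ᵐ ω' ∂P, (R ω, U ω') ∈ A := by
      filter_upwards [hω] with ω' hω'
      have h1 := ((Real.continuous_arctan.tendsto _).comp hω').sub hVω
      rw [sub_self] at h1
      exact h1
    exact this
  have hmem : ∀ᵐ ω ∂P, (R ω, U ω) ∈ A := by
    have hprod := (indepFun_iff_map_prod_eq_prod_map_map hR.aemeasurable hU.aemeasurable).1 hRU
    have h0 : P.map (fun ω => (R ω, U ω)) Aᶜ = 0 := by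
      rw [hprod, Measure.prod_apply hA.compl,
        lintegral_map (measurable_measure_prodMk_left hA.compl) hR]
      exact (lintegral_congr_ae hfib).trans lintegral_zero
    rwa [Measure.map_apply (hR.prodMk hU) hA.compl] at h0
  filter_upwards [hmem, hVlim] with ω h1 h2
  have h3 : Tendsto (fun n => Y n (R ω, U ω)) atTop (𝓝 (Real.arctan (v ω))) := by
    have := Tendsto.add (show Tendsto (fun n => Y n (R ω, U ω) - V n (R ω)) atTop (𝓝 0) from h1) h2
    rw [zero_add] at this
    exact this.congr fun n => sub_add_cancel _ _
  have h4 := (Real.continuousAt_tan.2 (Real.cos_arctan_pos (v ω)).ne').tendsto.comp h3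
  rw [Real.tan_arctan] at h4
  refine h4.congr fun n => ?_
  simp only [Function.comp, Y, Real.tan_arctan]

/-! ### Joint measurability of the block counts -/

/-- The Effros σ-algebra is generated by open hitting events, while blocks involve closed intervals
with random endpoints. Rational open intervals that shrink to `[a, b]` bridge the two, by
compactness of `[a, b]`. -/
theorem nonempty_inter_Icc_iff {F : Set ℝ} (hF : IsClosed F) {a b : ℝ} (hab : a ≤ b) :
    (F ∩ Icc a b).Nonempty ↔ ∀ k : ℕ, ∃ q r : ℚ, a - 1 / (k + 1) < q ∧ r < b + 1 / (k + 1) ∧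
      (F ∩ Ioo (q : ℝ) r).Nonempty := by
  constructor
  · rintro ⟨x, hxF, hx⟩ k
    have hk : (0 : ℝ) < 1 / (k + 1) := Nat.one_div_pos_of_nat
    obtain ⟨q, hq1, hq2⟩ := exists_rat_btwn (show a - 1 / ((k : ℝ) + 1) < a by linarith)
    obtain ⟨r, hr1, hr2⟩ := exists_rat_btwn (show b < b + 1 / ((k : ℝ) + 1) by linarith)
    exact ⟨q, r, hq1, hr2, x, hxF, hq2.trans_le hx.1, hx.2.trans_lt hr1⟩
  · intro h
    by_contra hne
    rw [not_nonempty_iff_eq_empty, ← disjoint_iff_inter_eq_empty] at hne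
    obtain ⟨δ, hδ, hsub⟩ := isCompact_Icc.exists_thickening_subset_open hF.isOpen_compl
      (Set.subset_compl_iff_disjoint_left.2 hne)
    obtain ⟨k, hk⟩ := exists_nat_one_div_lt hδ
    obtain ⟨q, r, hq, hr, x, hxF, hx1, hx2⟩ := h k
    refine hsub ?_ hxF
    rw [Metric.mem_thickening_iff]
    -- The witness is the projection of `x` onto `[a, b]`.
    refine ⟨max a (min b x), ⟨le_max_left _ _, max_le hab (min_le_left _ _)⟩, ?_⟩
    rw [Real.dist_eq, abs_lt]
    rcases le_total b x with h1 | h1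
    · rw [min_eq_left h1, max_eq_right hab]
      constructor <;> linarith
    · rw [min_eq_right h1]
      rcases le_total a x with h2 | h2
      · rw [max_eq_right h2]
        constructor <;> linarith
      · rw [max_eq_left h2]
        constructor <;> linarith

theorem measurableSet_inter_uIcc_eq_empty (i j : ℕ) :
    MeasurableSet {x : TopologicalSpace.Closeds ℝ × (ℕ → ℝ) |
      (x.1 : Set ℝ) ∩ uIcc (x.2 i) (x.2 j) = ∅} := by
  have hhit : ∀ q r : ℚ, MeasurableSet
      {x : TopologicalSpace.Closeds ℝ × (ℕ → ℝ) | ((x.1 : Set ℝ) ∩ Ioo (q : ℝ) r).Nonempty} := by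
    intro q r
    have h : MeasurableSet {F : TopologicalSpace.Closeds ℝ | ((F : Set ℝ) ∩ Ioo (q : ℝ) r).Nonempty} :=
      MeasurableSpace.measurableSet_generateFrom ⟨Ioo (q : ℝ) r, isOpen_Ioo, rfl⟩
    exact measurable_fst h
  have hi : Measurable fun x : TopologicalSpace.Closeds ℝ × (ℕ → ℝ) => x.2 i :=
    (measurable_pi_apply i).comp measurable_snd
  have hj : Measurable fun x : TopologicalSpace.Closeds ℝ × (ℕ → ℝ) => x.2 j :=
    (measurable_pi_apply j).comp measurable_snd
  have heq : {x : TopologicalSpace.Closeds ℝ × (ℕ → ℝ) |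
      (x.1 : Set ℝ) ∩ uIcc (x.2 i) (x.2 j) = ∅}
      = (⋂ k : ℕ, ⋃ q : ℚ, ⋃ r : ℚ, {x | min (x.2 i) (x.2 j) - 1 / (k + 1) < (q : ℝ)} ∩
        ({x | (r : ℝ) < max (x.2 i) (x.2 j) + 1 / (k + 1)} ∩
          {x | ((x.1 : Set ℝ) ∩ Ioo (q : ℝ) r).Nonempty}))ᶜ := by
    ext x
    simp only [mem_ofPred_eq, mem_compl_iff, mem_iInter, mem_iUnion, mem_inter_iff]
    rw [← nonempty_inter_Icc_iff x.1.isClosed (min_le_max), not_nonempty_iff_eq_empty]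
    rfl
  rw [heq]
  refine (MeasurableSet.iInter fun k => MeasurableSet.iUnion fun q => MeasurableSet.iUnion fun r =>
    (measurableSet_lt ?_ measurable_const).inter ((measurableSet_lt measurable_const ?_).inter
      (hhit q r))).compl
  · exact (hi.min hj).sub_const _
  · exact (hi.max hj).add_const _

instance setoidFinFinite (n : ℕ) : Finite (Setoid (Fin n)) :=
  Finite.of_injective (fun s : Setoid (Fin n) => fun i j => s i j) fun s t h => by
    ext i j
    exact iff_of_eq (congrFun (congrFun h i) j)

/-- Every functional of the block partition is measurable. -/
theorem measurable_of_blockSetoid {n : ℕ} (g : Setoid (Fin n) → ℝ) :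
    Measurable fun x : TopologicalSpace.Closeds ℝ × (ℕ → ℝ) =>
      g (blockSetoid (x.1 : Set ℝ) fun i : Fin n => x.2 i) := by
  -- There are only finitely many setoids on `Fin n`, so it suffices to measure single fibres, and
  -- every `g` is measurable for the full σ-algebra.
  let _ : MeasurableSpace (Setoid (Fin n)) := ⊤
  have hs : Measurable fun x : TopologicalSpace.Closeds ℝ × (ℕ → ℝ) =>
      blockSetoid (x.1 : Set ℝ) fun i : Fin n => x.2 i := by
    refine measurable_to_countable' fun s => ?_
    have : (fun x : TopologicalSpace.Closeds ℝ × (ℕ → ℝ) =>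
        blockSetoid (x.1 : Set ℝ) fun i : Fin n => x.2 i) ⁻¹' {s}
        = ⋂ i : Fin n, ⋂ j : Fin n, {x | (i = j ∨ (x.1 : Set ℝ) ∩ uIcc (x.2 i) (x.2 j) = ∅)
          ↔ s i j} := by
      ext x
      simp only [mem_preimage, mem_singleton_iff, mem_iInter, mem_ofPred_eq]
      exact Setoid.ext_iff
    rw [this]
    refine MeasurableSet.iInter fun i => MeasurableSet.iInter fun j => ?_
    exact ((MeasurableSet.const (i = j)).union (measurableSet_inter_uIcc_eq_empty i j)).iff
      (MeasurableSet.const _)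
  exact (measurable_from_top (f := g)).comp hs

/-- Sorting the blocks from left to right is a permutation, which counts do not see. -/
theorem numParts_eq_card (F : Set ℝ) (v : ℕ → ℝ) (n : ℕ) :
    numParts F v n = (blockPartition F fun i : Fin n => v i).parts.card := by
  simp [numParts, derivedComposition, Composition.length, blockList]

theorem numPartsEq_eq_card (F : Set ℝ) (v : ℕ → ℝ) (n r : ℕ) :
    numPartsEq F v n r
      = ((blockPartition F fun i : Fin n => v i).parts.filter fun B => B.card = r).card := by
  classical
  have h : (blockList F fun i : Fin n => v i).Perm
      (blockPartition F fun i : Fin n => v i).parts.toList := List.mergeSort_perm _ _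
  simp only [numPartsEq, derivedComposition]
  rw [(h.map _).count_eq, ← Multiset.coe_count, ← Multiset.map_coe, Finset.coe_toList,
    Multiset.count_map, ← Finset.filter_val]
  simp only [Finset.card, eq_comm]
  congr!

open scoped Classical in
/-- The equivalence classes of a setoid on a finite type. -/
noncomputable def setoidParts {n : ℕ} (s : Setoid (Fin n)) : Finset (Finset (Fin n)) :=
  (Finpartition.ofSetoid s).parts

theorem parts_blockPartition (F : Set ℝ) {n : ℕ} (v : Fin n → ℝ) :
    (blockPartition F v).parts = setoidParts (blockSetoid F v) := rfl

theorem measurable_numParts (n : ℕ) :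
    Measurable fun x : TopologicalSpace.Closeds ℝ × (ℕ → ℝ) =>
      (numParts (x.1 : Set ℝ) x.2 n : ℝ) := by
  simp only [numParts_eq_card, parts_blockPartition]
  exact measurable_of_blockSetoid fun s => ((setoidParts s).card : ℝ)

theorem measurable_numPartsEq (n r : ℕ) :
    Measurable fun x : TopologicalSpace.Closeds ℝ × (ℕ → ℝ) =>
      (numPartsEq (x.1 : Set ℝ) x.2 n r : ℝ) := by
  have h := measurable_of_blockSetoid (n := n) fun s =>
    (((setoidParts s).filter fun B => B.card = r).card : ℝ)
  have e : (fun x : TopologicalSpace.Closeds ℝ × (ℕ → ℝ) => (numPartsEq (x.1 : Set ℝ) x.2 n r : ℝ))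
      = fun x => (((setoidParts (blockSetoid (x.1 : Set ℝ) fun i : Fin n => x.2 i)).filter
        fun B => B.card = r).card : ℝ) := by
    funext x
    rw [numPartsEq_eq_card, parts_blockPartition]
  rw [e]
  exact h

/-! ### Blocks as occupied gaps -/

section Blocks

variable {F : Set ℝ} {v : ℕ → ℝ} {n : ℕ}

open scoped Classical in
/-- The indices of the first `n` points of `v` that lie in `A`. -/
noncomputable def hitIndices (v : ℕ → ℝ) (n : ℕ) (A : Set ℝ) : Finset (Fin n) :=
  Finset.univ.filter fun i : Fin n => v i ∈ A

theorem mem_hitIndices {A : Set ℝ} {i : Fin n} : i ∈ hitIndices v n A ↔ v i ∈ A := by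
  simp [hitIndices]

theorem card_hitIndices (v : ℕ → ℝ) (n : ℕ) (A : Set ℝ) : (hitIndices v n A).card = hits A v n := by
  classical
  rw [hits_eq_card_fin A v n (Q := fun i => v i ∈ A) fun _ => Iff.rfl, hitIndices]

theorem hits_pos_iff {A : Set ℝ} : 0 < hits A v n ↔ ∃ i : Fin n, v i ∈ A := by
  rw [← card_hitIndices, Finset.card_pos]
  simp only [Finset.Nonempty, mem_hitIndices]

theorem blockSetoid_iff (hv : ∀ i < n, v i ∈ Icc (0 : ℝ) 1 \ F) {C : Set ℝ} (hC : C ∈ gaps F)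
    {i j : Fin n} (hi : v i ∈ C) : (blockSetoid F fun i : Fin n => v i) i j ↔ v j ∈ C := by
  have h := inter_uIcc_eq_empty_iff (hv j j.2) hC hi
  change (i = j ∨ F ∩ uIcc (v i) (v j) = ∅) ↔ _
  rw [h]
  constructor
  · rintro (rfl | h)
    exacts [hi, h]
  · exact Or.inr

theorem part_blockPartition (hv : ∀ i < n, v i ∈ Icc (0 : ℝ) 1 \ F) {C : Set ℝ} (hC : C ∈ gaps F)
    {i : Fin n} (hi : v i ∈ C) :
    (blockPartition F fun i : Fin n => v i).part i = hitIndices v n C := by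
  classical
  ext j
  rw [blockPartition, Finpartition.mem_part_ofSetoid_iff_rel, blockSetoid_iff hv hC hi,
    mem_hitIndices]

/-- When the sample avoids `F`, each point lies in a gap and its block consists of all sample points
in that gap. -/
theorem coe_parts_blockPartition (hv : ∀ i < n, v i ∈ Icc (0 : ℝ) 1 \ F) :
    ((blockPartition F fun i : Fin n => v i).parts : Set (Finset (Fin n)))
      = (fun C : gaps F => hitIndices v n C) '' {C | 0 < hits (C : Set ℝ) v n} := by
  ext B
  simp only [Finset.mem_coe, mem_image, mem_ofPred_eq, hits_pos_iff]
  constructor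
  · intro hB
    obtain ⟨i, hi⟩ := (blockPartition F fun i : Fin n => v i).nonempty_of_mem_parts hB
    obtain ⟨C, hC⟩ := exists_gap_of_mem (hv i i.2)
    exact ⟨C, ⟨i, hC⟩, by
      rw [← part_blockPartition hv C.2 hC, Finpartition.part_eq_of_mem _ hB hi]⟩
  · rintro ⟨C, ⟨i, hi⟩, rfl⟩
    rw [← part_blockPartition hv C.2 hi]
    exact (Finpartition.part_mem _).2 (Finset.mem_univ i)

theorem injOn_hitIndices :
    InjOn (fun C : gaps F => hitIndices v n C) {C | 0 < hits (C : Set ℝ) v n} := by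
  intro C hC D _ hCD
  obtain ⟨i, hi⟩ := hits_pos_iff.1 (show 0 < hits (C : Set ℝ) v n from hC)
  have hi' : v i ∈ (D : Set ℝ) := by
    have h : hitIndices v n (C : Set ℝ) = hitIndices v n (D : Set ℝ) := hCD
    rw [← mem_hitIndices (n := n), ← h]
    exact mem_hitIndices.2 hi
  exact Subtype.ext ((gaps_eq_of_mem C.2 hi).trans (gaps_eq_of_mem D.2 hi').symm)

theorem numParts_eq_occupied (hv : ∀ i < n, v i ∈ Icc (0 : ℝ) 1 \ F) :
    numParts F v n = occupied (fun C : gaps F => (C : Set ℝ)) v n 0 := by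
  rw [numParts_eq_card, ← ncard_coe_finset, coe_parts_blockPartition hv,
    injOn_hitIndices.ncard_image, occupied]

theorem numPartsEq_eq_ncard (hv : ∀ i < n, v i ∈ Icc (0 : ℝ) 1 \ F) {r : ℕ} (hr : 0 < r) :
    numPartsEq F v n r = {C : gaps F | hits (C : Set ℝ) v n = r}.ncard := by
  have hsub : {C : gaps F | hits (C : Set ℝ) v n = r} ⊆ {C : gaps F | 0 < hits (C : Set ℝ) v n} :=
    fun C (hC : hits (C : Set ℝ) v n = r) => show 0 < hits (C : Set ℝ) v n by rwa [hC]
  rw [numPartsEq_eq_card, ← ncard_coe_finset, ← (injOn_hitIndices.mono hsub).ncard_image]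
  congr 1
  have hparts := coe_parts_blockPartition hv
  ext B
  rw [Finset.coe_filter, mem_ofPred_eq, ← Finset.mem_coe, hparts]
  simp only [mem_image, mem_ofPred_eq]
  constructor
  · rintro ⟨⟨C, hC, rfl⟩, h⟩
    exact ⟨C, by rw [← h, card_hitIndices], rfl⟩
  · rintro ⟨C, hC, rfl⟩
    exact ⟨⟨C, hsub hC, rfl⟩, by rw [card_hitIndices, hC]⟩

theorem pairwise_disjoint_gaps :
    Pairwise (Function.onFun Disjoint fun C : gaps F => (C : Set ℝ)) := fun C D hne =>
  gaps_pairwiseDisjoint C.2 D.2 (Subtype.coe_injective.ne hne)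

theorem numPartsEq_eq_sub (hv : ∀ i < n, v i ∈ Icc (0 : ℝ) 1 \ F) (s : ℕ) :
    (numPartsEq F v n (s + 1) : ℝ)
      = (occupied (fun C : gaps F => (C : Set ℝ)) v n s : ℝ)
        - occupied (fun C : gaps F => (C : Set ℝ)) v n (s + 1) := by
  rw [numPartsEq_eq_ncard hv s.succ_pos, eq_sub_iff_add_eq, occupied, occupied, ← Nat.cast_add,
    ← ncard_union_eq ?_ ?_ (finite_lt_hits pairwise_disjoint_gaps v n (s + 1))]
  · congr 2
    ext C
    simp only [mem_union, mem_ofPred_eq]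
    omega
  · rw [Set.disjoint_left]
    intro C h1 h2
    simp only [mem_ofPred_eq] at h1 h2
    omega
  · refine (finite_lt_hits pairwise_disjoint_gaps v n s).subset fun C hC => ?_
    simp only [mem_ofPred_eq] at hC ⊢
    omega

end Blocks

/-! ### Limit theorems for a fixed closed null set -/

section FixedSet

variable {Ω : Type*} [MeasurableSpace Ω] {P : Measure Ω} {u : ℕ → Ω → ℝ} {F : Set ℝ}

theorem ae_forall_mem_sdiff (humeas : ∀ i, Measurable (u i))
    (huunif : ∀ i, P.map (u i) = volume.restrict (Icc 0 1)) (hF : IsClosed F)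
    (hnull : volume F = 0) : ∀ᵐ ω ∂P, ∀ i, u i ω ∈ Icc (0 : ℝ) 1 \ F := by
  refine ae_all_iff.2 fun i => ?_
  have hm : MeasurableSet (Icc (0 : ℝ) 1 \ F) := measurableSet_Icc.diff hF.measurableSet
  rw [← ae_map_iff (humeas i).aemeasurable (p := fun x => x ∈ Icc (0 : ℝ) 1 \ F) hm, huunif i]
  filter_upwards [ae_restrict_mem measurableSet_Icc,
    ae_restrict_of_ae (measure_eq_zero_iff_ae_notMem.1 hnull)] with x h1 h2 using ⟨h1, h2⟩

theorem prob_preimage_gap (humeas : ∀ i, Measurable (u i))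
    (huunif : ∀ i, P.map (u i) = volume.restrict (Icc 0 1)) (k : ℕ) (C : gaps F) :
    P.real (u k ⁻¹' C) = gapLength F C := by
  have hm := gaps_measurableSet C.2
  rw [← map_measureReal_apply (humeas k) hm, huunif k, measureReal_restrict_apply hm,
    inter_eq_left.2 ((gaps_subset C.2).trans sdiff_subset), gapLength]

variable [IsProbabilityMeasure P]

/-- The number of gaps that contain more than `s` sample points is asymptotic to its mean. -/
theorem ae_tendsto_occupied (humeas : ∀ i, Measurable (u i))
    (huunif : ∀ i, P.map (u i) = volume.restrict (Icc 0 1)) (hind : iIndepFun u P)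
    (hF : IsClosed F) {f : ℝ → ℝ} (hf : SlowlyVarying f) {α c : ℝ} (hα : 0 < α) {s : ℕ}
    (hM : Tendsto (fun n : ℕ => meanOccupied (gapLength F) n s / ((n : ℝ) ^ α * f n)) atTop
      (𝓝 c)) :
    ∀ᵐ ω ∂P, Tendsto (fun n : ℕ => (occupied (fun C : gaps F => (C : Set ℝ))
      (fun i => u i ω) n s : ℝ) / ((n : ℝ) ^ α * f n)) atTop (𝓝 c) := by
  have : Countable (gaps F) := (gaps_countable hF).to_subtype
  have hm : ∀ C : gaps F, MeasurableSet (C : Set ℝ) := fun C => gaps_measurableSet C.2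
  refine ae_tendsto_of_variance_le (M := fun n => meanOccupied (gapLength F) n s)
    (fun n => ?_) (fun ω n m h => ?_) (fun n => ?_) hf hα hM
  · simpa using (measurable_occupied humeas pairwise_disjoint_gaps hm n s).ennreal_toReal
  · exact Nat.cast_le.2 (occupied_mono pairwise_disjoint_gaps _ s h)
  · exact lintegral_sq_sub_meanOccupied_le hind humeas
      (fun i => (huunif i).trans (huunif 0).symm) pairwise_disjoint_gaps hm
      (prob_preimage_gap humeas huunif) (tsum_ofReal_gap_le hF) n s

theorem tendsto_meanOccupied {l : ℝ → ℝ} (hl : SlowlyVarying l) (hF : IsClosed F) {α lam : ℝ}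
    {s : ℕ} (hα : 0 < α) (hαs : α < s + 1) (hlam : 0 ≤ lam)
    (hlim : Tendsto (fun x : ℝ => (gapCount F x : ℝ) / (l (1 / x) * x ^ (-α))) (𝓝[>] 0)
      (𝓝 lam)) :
    Tendsto (fun n : ℕ => meanOccupied (gapLength F) n s / ((n : ℝ) ^ α * l n)) atTop
      (𝓝 (Real.Gamma (s + 1 - α) / s.factorial * lam)) :=
  tendsto_integral_orderDensity hl hα hαs hlam (countingFun_antitoneOn (tsum_ofReal_gap_le hF))
    (fun _ _ => Nat.cast_nonneg _) (by simpa only [gapCount_eq_countingFun] using hlim)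

theorem ae_tendsto_numPartsEq_succ (humeas : ∀ i, Measurable (u i))
    (huunif : ∀ i, P.map (u i) = volume.restrict (Icc 0 1)) (hind : iIndepFun u P)
    (hF : IsClosed F) (hnull : volume F = 0) {l : ℝ → ℝ} (hl : SlowlyVarying l) {α lam : ℝ}
    {s : ℕ} (hα : 0 < α) (hαs : α < s + 1) (hlam : 0 ≤ lam)
    (hlim : Tendsto (fun x : ℝ => (gapCount F x : ℝ) / (l (1 / x) * x ^ (-α))) (𝓝[>] 0)
      (𝓝 lam)) :
    ∀ᵐ ω ∂P, Tendsto (fun n : ℕ => (numPartsEq F (fun i => u i ω) n (s + 1) : ℝ)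
        / ((n : ℝ) ^ α * l n)) atTop
      (𝓝 (α * Real.Gamma (s + 1 - α) / ((s + 1).factorial : ℝ) * lam)) := by
  have hM := tendsto_meanOccupied hl hF hα hαs hlam hlim
  have hM' := tendsto_meanOccupied hl hF (s := s + 1) hα (by push_cast; linarith) hlam hlim
  filter_upwards [ae_tendsto_occupied humeas huunif hind hF hl hα hM,
    ae_tendsto_occupied humeas huunif hind hF hl hα hM',
    ae_forall_mem_sdiff humeas huunif hF hnull] with ω h1 h2 hω
  have h3 := h1.sub h2
  -- By the functional equation the second term is the first times `(s+1-α)/(s+1)`, so the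
  -- difference is the first times `α/(s+1)`.
  have e : Real.Gamma (s + 1 - α) / s.factorial * lam
      - Real.Gamma ((s + 1 : ℕ) + 1 - α) / (s + 1).factorial * lam
      = α * Real.Gamma (s + 1 - α) / ((s + 1).factorial : ℝ) * lam := by
    rw [show ((s + 1 : ℕ) : ℝ) + 1 - α = (s + 1 - α) + 1 by push_cast; ring,
      Real.Gamma_add_one (by linarith), Nat.factorial_succ]
    have : (s.factorial : ℝ) ≠ 0 := by exact_mod_cast Nat.factorial_ne_zero s
    push_cast
    field_simp
    ring
  rw [e] at h3
  refine h3.congr fun n => ?_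
  rw [numPartsEq_eq_sub (fun i _ => hω i), sub_div]

theorem ae_tendsto_numParts (humeas : ∀ i, Measurable (u i))
    (huunif : ∀ i, P.map (u i) = volume.restrict (Icc 0 1)) (hind : iIndepFun u P)
    (hF : IsClosed F) (hnull : volume F = 0) {l : ℝ → ℝ} (hl : SlowlyVarying l) {α lam : ℝ}
    (hα : 0 < α) (hα1 : α < 1) (hlam : 0 ≤ lam)
    (hlim : Tendsto (fun x : ℝ => (gapCount F x : ℝ) / (l (1 / x) * x ^ (-α))) (𝓝[>] 0)
      (𝓝 lam)) :
    ∀ᵐ ω ∂P, Tendsto (fun n : ℕ => (numParts F (fun i => u i ω) n : ℝ) / ((n : ℝ) ^ α * l n))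
      atTop (𝓝 (Real.Gamma (1 - α) * lam)) := by
  have hM := tendsto_meanOccupied hl hF (s := 0) hα (by simpa using hα1) hlam hlim
  filter_upwards [ae_tendsto_occupied humeas huunif hind hF hl hα hM,
    ae_forall_mem_sdiff humeas huunif hF hnull] with ω h1 hω
  simp only [Nat.cast_zero, zero_add, Nat.factorial_zero, Nat.cast_one, div_one] at h1
  refine h1.congr fun n => ?_
  rw [numParts_eq_occupied fun i _ => hω i]

/-- Gaps with at least two points number `O(n l(n))`, which is `o(n lstar l n)`; hence the
singletons carry the whole limit. Only the mean for `s = 0` needs `lstar`. -/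
theorem ae_tendsto_div_lstar (humeas : ∀ i, Measurable (u i))
    (huunif : ∀ i, P.map (u i) = volume.restrict (Icc 0 1)) (hind : iIndepFun u P)
    (hF : IsClosed F) (hnull : volume F = 0) {l : ℝ → ℝ} (hl : SlowlyVarying l) {lam t₀ : ℝ}
    (hlam : 0 ≤ lam) (ht₀ : 0 < t₀) (hi : IntegrableOn (starIntegrand l t₀) (Ioi 0))
    (hlim : Tendsto (fun x : ℝ => (gapCount F x : ℝ) / (l (1 / x) * x ^ (-1 : ℝ))) (𝓝[>] 0)
      (𝓝 lam)) :
    ∀ᵐ ω ∂P,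
      Tendsto (fun n : ℕ => (numParts F (fun i => u i ω) n : ℝ) / (n * lstar l n)) atTop
        (𝓝 lam) ∧
      Tendsto (fun n : ℕ => (numPartsEq F (fun i => u i ω) n 1 : ℝ) / (n * lstar l n)) atTop
        (𝓝 lam) := by
  have : Countable (gaps F) := (gaps_countable hF).to_subtype
  have hsum := tsum_ofReal_gap_le hF
  have hik := (integrableOn_starIntegrand_iff l ht₀).1 hi
  have hls := slowlyVarying_lstar hl ht₀ hik
  have hlim' := hlim
  simp only [gapCount_eq_countingFun] at hlim'
  have hM0 : Tendsto (fun n : ℕ => meanOccupied (gapLength F) n 0 / ((n : ℝ) ^ (1 : ℝ) * lstar l n))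
      atTop (𝓝 lam) := by
    simp only [Real.rpow_one]
    exact tendsto_integral_orderDensity_zero hl ht₀ hi (integrableOn_countingFun hsum)
      (fun _ _ => Nat.cast_nonneg _)
      (fun x hx => by exact_mod_cast countingFun_eq_zero hsum hx) hlim'
  have hM1 := tendsto_meanOccupied hl hF (s := 1) one_pos (by norm_num) hlam hlim
  filter_upwards [ae_tendsto_occupied humeas huunif hind hF hls one_pos hM0,
    ae_tendsto_occupied humeas huunif hind hF hl one_pos hM1,
    ae_forall_mem_sdiff humeas huunif hF hnull] with ω h0 h1 hω
  simp only [Real.rpow_one] at h0 h1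
  refine ⟨h0.congr fun n => by rw [numParts_eq_occupied fun i _ => hω i], ?_⟩
  have h2 := h1.mul ((tendsto_div_lstar hl ht₀ hik).comp tendsto_natCast_atTop_atTop)
  rw [mul_zero] at h2
  have h3 := h0.sub h2
  rw [sub_zero] at h3
  refine h3.congr' ?_
  have hnat := tendsto_natCast_atTop_atTop (R := ℝ)
  filter_upwards [hnat.eventually hl.eventually_pos, hnat.eventually hls.eventually_pos,
    eventually_gt_atTop 0] with n p1 p2 hn
  have hn' : (0 : ℝ) < n := by exact_mod_cast hn
  rw [numPartsEq_eq_sub (s := 0) (fun i _ => hω i)]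
  simp only [Function.comp, zero_add]
  field_simp

end FixedSet

/-! ### Conclusion for the random set -/

theorem theorem2p1 {Ω : Type*} [MeasurableSpace Ω] (P : Measure Ω) [IsProbabilityMeasure P]
    (R : Ω → TopologicalSpace.Closeds ℝ) (hRmeas : Measurable R)
    (hRsub : ∀ ω, (R ω : Set ℝ) ⊆ Icc 0 1)
    (hRnull : ∀ᵐ ω ∂P, volume (R ω : Set ℝ) = 0)
    (u : ℕ → Ω → ℝ) (humeas : ∀ i, Measurable (u i))
    (huunif : ∀ i, P.map (u i) = volume.restrict (Icc 0 1))
    (huindep : iIndepFun u P)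
    (hRu : IndepFun R (fun ω i => u i ω) P)
    (l : ℝ → ℝ) (hl : SlowlyVarying l)
    (L : Ω → ℝ) (hLmeas : AEMeasurable L P) (hLnonneg : ∀ᵐ ω ∂P, 0 ≤ L ω) :
    (∀ α : ℝ, 0 < α → α < 1 →
      (∀ᵐ ω ∂P, Tendsto (fun x : ℝ => (gapCount (R ω) x : ℝ) / (l (1 / x) * x ^ (-α)))
        (𝓝[>] 0) (𝓝 (L ω))) →
      ∀ᵐ ω ∂P,
        Tendsto (fun n : ℕ => (numParts (R ω) (fun i => u i ω) n : ℝ) / ((n : ℝ) ^ α * l n))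
          atTop (𝓝 (Real.Gamma (1 - α) * L ω)) ∧
        ∀ r : ℕ, 1 ≤ r →
          Tendsto
            (fun n : ℕ => (numPartsEq (R ω) (fun i => u i ω) n r : ℝ) / ((n : ℝ) ^ α * l n))
            atTop (𝓝 (α * Real.Gamma (r - α) / (r.factorial : ℝ) * L ω))) ∧
    ((∀ᵐ ω ∂P, Tendsto (fun x : ℝ => (gapCount (R ω) x : ℝ) / (l (1 / x) * x ^ (-1 : ℝ)))
        (𝓝[>] 0) (𝓝 (L ω))) →
      (∀ᵐ ω ∂P, ∀ r : ℕ, 1 < r →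
        Tendsto (fun n : ℕ => (numPartsEq (R ω) (fun i => u i ω) n r : ℝ) / ((n : ℝ) * l n))
          atTop (𝓝 (1 / ((r : ℝ) * ((r : ℝ) - 1)) * L ω))) ∧
      -- convergence of the integral at its upper end
      (∀ t₀ : ℝ, 0 < t₀ → (∀ b : ℝ, 0 < b → IntegrableOn (starIntegrand l t₀) (Ioc 0 b)) →
        ¬ (∀ᵐ ω ∂P, L ω = 0) → IntegrableOn (starIntegrand l t₀) (Ioi 0)) ∧
      -- the limits that involve `ℓ^*`
      (∀ t₀ : ℝ, 0 < t₀ → IntegrableOn (starIntegrand l t₀) (Ioi 0) →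
        (∀ t : ℝ, t₀ ≤ t → IntegrableOn (starIntegrand l t) (Ioi 0)) ∧
        SlowlyVarying (lstar l) ∧
        ∀ᵐ ω ∂P,
          Tendsto (fun n : ℕ => (numParts (R ω) (fun i => u i ω) n : ℝ) / ((n : ℝ) * lstar l n))
            atTop (𝓝 (L ω)) ∧
          Tendsto
            (fun n : ℕ => (numPartsEq (R ω) (fun i => u i ω) n 1 : ℝ) / ((n : ℝ) * lstar l n))
            atTop (𝓝 (L ω)))) := by
  have hU : Measurable fun ω i => u i ω := measurable_pi_lambda _ humeas
  -- The set is frozen at `ω` while the sample runs over an independent `ω'`; in this form the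
  -- theorems for fixed sets apply for almost every `ω`.
  have transfer : ∀ (X : ℕ → TopologicalSpace.Closeds ℝ × (ℕ → ℝ) → ℝ) (v : Ω → ℝ),
      (∀ n, Measurable (X n)) →
      (∀ᵐ ω ∂P, ∀ᵐ ω' ∂P, Tendsto (fun n => X n (R ω, fun i => u i ω')) atTop (𝓝 (v ω))) →
      ∀ᵐ ω ∂P, Tendsto (fun n => X n (R ω, fun i => u i ω)) atTop (𝓝 (v ω)) :=
    fun X v hX h => ae_tendsto_of_indepFun hRmeas hU hRu hX h
  refine ⟨fun α hα hα1 hlim => ?_, fun hlim => ⟨?_, fun t₀ ht₀ hb hL0 => ?_, fun t₀ ht₀ hi => ?_⟩⟩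
  · refine Filter.Eventually.and ?_ ?_
    · refine transfer (fun n x => (numParts (x.1 : Set ℝ) x.2 n : ℝ) / ((n : ℝ) ^ α * l n)) _
        (fun n => (measurable_numParts n).div_const _) ?_
      filter_upwards [hlim, hRnull, hLnonneg] with ω h1 h2 h3
      exact ae_tendsto_numParts humeas huunif huindep (R ω).isClosed h2 hl hα hα1 h3 h1
    · have h : ∀ s : ℕ, ∀ᵐ ω ∂P, Tendsto
          (fun n : ℕ => (numPartsEq (R ω) (fun i => u i ω) n (s + 1) : ℝ) / ((n : ℝ) ^ α * l n))
          atTop (𝓝 (α * Real.Gamma (s + 1 - α) / ((s + 1).factorial : ℝ) * L ω)) := by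
        intro s
        refine transfer (fun n x => (numPartsEq (x.1 : Set ℝ) x.2 n (s + 1) : ℝ)
          / ((n : ℝ) ^ α * l n)) _ (fun n => (measurable_numPartsEq n (s + 1)).div_const _) ?_
        filter_upwards [hlim, hRnull, hLnonneg] with ω h1 h2 h3
        exact ae_tendsto_numPartsEq_succ humeas huunif huindep (R ω).isClosed h2 hl hα
          (hα1.trans_le (by linarith [(Nat.cast_nonneg s : (0 : ℝ) ≤ s)])) h3 h1
      filter_upwards [ae_all_iff.2 h] with ω hω r hr
      obtain ⟨s, rfl⟩ := Nat.exists_eq_add_of_le' hr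
      simpa using hω s
  · have h : ∀ s : ℕ, ∀ᵐ ω ∂P, Tendsto
        (fun n : ℕ => (numPartsEq (R ω) (fun i => u i ω) n (s + 2) : ℝ) / ((n : ℝ) * l n))
        atTop (𝓝 (1 / (((s + 2 : ℕ) : ℝ) * (((s + 2 : ℕ) : ℝ) - 1)) * L ω)) := by
      intro s
      refine transfer (fun n x => (numPartsEq (x.1 : Set ℝ) x.2 n (s + 2) : ℝ)
        / ((n : ℝ) * l n)) _ (fun n => (measurable_numPartsEq n (s + 2)).div_const _) ?_
      filter_upwards [hlim, hRnull, hLnonneg] with ω h1 h2 h3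
      have h4 := ae_tendsto_numPartsEq_succ humeas huunif huindep (R ω).isClosed h2 hl
        (s := s + 1) one_pos (by push_cast; linarith [(Nat.cast_nonneg s : (0 : ℝ) ≤ s)]) h3 h1
      -- With `r = s + 2` and `α = 1` the constant is `s! / (s+2)!`.
      have e : 1 * Real.Gamma ((s + 1 : ℕ) + 1 - 1) / ((s + 1 + 1).factorial : ℝ)
          = 1 / (((s + 2 : ℕ) : ℝ) * (((s + 2 : ℕ) : ℝ) - 1)) := by
        have hs : (s.factorial : ℝ) ≠ 0 := by exact_mod_cast Nat.factorial_ne_zero s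
        have e1 : ((s + 1 : ℕ) : ℝ) + 1 - 1 = s + 1 := by push_cast; ring
        have e2 : ((s + 2 : ℕ) : ℝ) - 1 = s + 1 := by push_cast; ring
        rw [e1, e2, Real.Gamma_nat_eq_factorial, Nat.factorial_succ, Nat.factorial_succ]
        push_cast
        field_simp
        ring
      rw [e] at h4
      simpa only [Real.rpow_one] using h4
    filter_upwards [ae_all_iff.2 h] with ω hω r hr
    obtain ⟨s, rfl⟩ := Nat.exists_eq_add_of_le' (show 2 ≤ r from hr)
    exact hω s
  -- The conclusion is not random, so one realisation with `L ω > 0` and the assumed gap asymptotics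
  -- is enough.
  · obtain ⟨ω, h0, h1, h2⟩ : ∃ ω, L ω ≠ 0 ∧ 0 ≤ L ω ∧
        Tendsto (fun x : ℝ => (gapCount (R ω) x : ℝ) / (l (1 / x) * x ^ (-1 : ℝ)))
          (𝓝[>] 0) (𝓝 (L ω)) :=
      ((Filter.not_eventually.1 hL0).and_eventually (hLnonneg.and hlim)).exists
    have : Countable (gaps (R ω : Set ℝ)) := (gaps_countable (R ω).isClosed).to_subtype
    simp only [gapCount_eq_countingFun] at h2
    exact integrableOn_starIntegrand_of_counting hl ht₀ (lt_of_le_of_ne h1 (Ne.symm h0))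
      (integrableOn_countingFun (tsum_ofReal_gap_le (R ω).isClosed)) h2 hb
  · have hik := (integrableOn_starIntegrand_iff l ht₀).1 hi
    refine ⟨fun t ht => (integrableOn_starIntegrand_iff l (ht₀.trans_le ht)).2
      (integrableOn_starKernel_mono ht hik), slowlyVarying_lstar hl ht₀ hik,
      Filter.Eventually.and ?_ ?_⟩
    · refine transfer (fun n x => (numParts (x.1 : Set ℝ) x.2 n : ℝ) / ((n : ℝ) * lstar l n)) _
        (fun n => (measurable_numParts n).div_const _) ?_
      filter_upwards [hlim, hRnull, hLnonneg] with ω h1 h2 h3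
      exact (ae_tendsto_div_lstar humeas huunif huindep (R ω).isClosed h2 hl h3 ht₀ hi h1).mono
        fun _ h => h.1
    · refine transfer (fun n x => (numPartsEq (x.1 : Set ℝ) x.2 n 1 : ℝ) / ((n : ℝ) * lstar l n)) _
        (fun n => (measurable_numPartsEq n 1).div_const _) ?_
      filter_upwards [hlim, hRnull, hLnonneg] with ω h1 h2 h3
      exact (ae_tendsto_div_lstar humeas huunif huindep (R ω).isClosed h2 hl h3 ht₀ hi h1).mono
        fun _ h => h.2
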